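/- **Setting.** A canonical exponential family on $\mathbb R$ is given by a reference measure $\nu$, a measurable $c:\mathbb R\to\mathbb R$ and a twice continuously differentiable $b:\mathbb R\to\mathbb R$ such that $dP_\eta(r)=\exp(r\eta-b(\eta)+c(r))\,d\nu(r)$ is a probability measure for every $\eta\in\mathbb R$; put $\mu=\dot b$. Let $d\ge 1$, $T\ge 2$. In round $t=1,\dots,T$ a learner receives an action set $\mathcal A_t\subset\mathbb R^d$ (possibly random), plays $a_t\in\mathcal A_t$, which is measurable with respect to the information $\mathcal F_t$ available at round $t$, and then observes an $\mathcal F_{t+1}$-measurable reward $r_{t+1}$ whose conditional law given $\mathcal F_t$ is $P_{a_t^\top\theta^\star_t}$, where $(\theta_t^\star)$ is a deterministic sequence in $\mathbb R^d$ that changes at most $\Gamma_T\ge 1$ times within the $T$ rounds. Assume that 1. $\|\theta^\star_t\|_2\le S$ for all $t$, and $\|a\|_2\le 1$ for all $a\in\mathcal A_t$; 2. $0\le r_{t+1}\le m$ almost surely, with $m>0$; 3. $\mu$ is $k_\mu$-Lipschitz and $c_\mu:=\inf\{\dot\mu(a^\top\theta):\|\theta\|_2\le S,\ \|a\|_2\le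 1\}>0$; 4. $|\ddot\mu|\le\dot\mu$ on $\mathbb R$; 5. (minimum gap) $\Delta>0$ and, for all $t\le T$ and all $a\in\mathcal A_t$ with $\mu(a^\top\theta^\star_t)<\max_{a'\in\mathcal A_t}\mu(a'^\top\theta^\star_t)$, one has $\max_{a'\in\mathcal A_t}\mu(a'^\top\theta^\star_t)-\mu(a^\top\theta^\star_t)\ge\Delta$. The regret is $R_T=\sum_{t=1}^T\big(\max_{a\in\mathcal A_t}\mu(a^\top\theta_t^\star)-\mu(a_t^\top\theta_t^\star)\big)$. **Algorithm SW-GLUCB** (with parameters $\delta\in(0,1]$, $\lambda>0$, real window length $\tau>0$). At round $t$ let $W_t=\{s\in\mathbb N:\max(1,t-\tau)\le s\le t-1\}$ and $$V_t=\sum_{s\in W_t}a_sa_s^\top+\frac{\lambda}{c_\mu}I_d,\qquad \hat\theta_t=\operatorname*{arg\,max}_{\theta\in\mathbb R^d}\ \sum_{s\in W_t}\big(r_{s+1}a_s^\top\theta-b(a_s^\top\theta)+c(r_{s+1})\big)-\frac\lambda2\|\theta\|_2^2,$$ $$\rho_t=\frac{\sqrt\lambda}{2m}+\frac{2m}{\sqrt\lambda}\log\frac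 T\delta+\frac{dm}{\sqrt\lambda}\log\Big(1+\frac{k_\mu\min(t,\tau)}{d\lambda}\Big)+\frac{2m}{\sqrt\lambda}d\log 2,$$ $$\beta_t=k_\mu\sqrt\lambda\Big(1+S+\sqrt{\tfrac{1+S}{\lambda}}\,\rho_t+\big(\tfrac{\rho_t}{\sqrt\lambda}\big)^2\Big)^{3/2}.$$ The algorithm plays any $a_t\in\operatorname{arg\,max}_{a\in\mathcal A_t}\ \mu(a^\top\hat\theta_t)+\frac{\beta_t}{\sqrt{c_\mu}}\sqrt{a^\top V_t^{-1}a}$. **Theorem.** There are a universal exponent $p\in\mathbb N$ and, for all $S$, $m$, $k_\mu$, a constant $C>0$ depending only on $S,m,k_\mu$, such that in every setting as above SW-GLUCB run with $$\lambda=d\log T,\qquad \tau=\frac{d\sqrt T}{\sqrt{c_\mu\Gamma_T}}$$ satisfies, with probability at least $1-\delta$, $$R_T\le C\,\Big(\log\frac T\delta\Big)^{p}\,\Delta^{-1}c_\mu^{-1/2}\,d\,\sqrt{\Gamma_T\,T}.$$ That is, $R_T=\widetilde{\mathcal O}\big(\Delta^{-1}c_\mu^{-1/2}d\sqrt{\Gamma_TT}\big)$.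 -/

import Mathlib

open MeasureTheory ProbabilityTheory
open scoped NNReal ENNReal

noncomputable section

namespace GLBandit

/-- Actions and parameters live in `ℝ^d` with the Euclidean norm. -/
abbrev Vec (d : ℕ) := EuclideanSpace ℝ (Fin d)

/-! ### Canonical exponential family -/

/-- Log-density `log p_η(r) = r η - b(η) + c(r)` with respect to the reference measure. -/
def logDensity (c b : ℝ → ℝ) (η r : ℝ) : ℝ := r * η - b η + c r

/-- The reward law with natural parameter `η`:
`dP_η(r) = exp (r η - b(η) + c(r)) dν(r)`. -/
def rewardLaw (ν : Measure ℝ) (c b : ℝ → ℝ) (η : ℝ) : Measure ℝ :=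
  ν.withDensity fun r => ENNReal.ofReal (Real.exp (logDensity c b η r))

/-- `(ν, c, b)` is a canonical exponential family on the whole real line, with `b` of class
`C²`. -/
structure IsExpFamily (ν : Measure ℝ) (c b : ℝ → ℝ) : Prop where
  measurable_c : Measurable c
  contDiff_b : ContDiff ℝ 2 b
  isProbabilityMeasure : ∀ η : ℝ, IsProbabilityMeasure (rewardLaw ν c b η)

/-- The mean function (inverse link) `μ = b'`. -/
def meanFn (b : ℝ → ℝ) : ℝ → ℝ := deriv b

/-- `c_μ = inf { μ'(⟨a, θ⟩) : ‖θ‖ ≤ S, ‖a‖ ≤ 1 }`. -/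
def cMu (d : ℕ) (S : ℝ) (b : ℝ → ℝ) : ℝ :=
  sInf {x : ℝ | ∃ θ a : Vec d, ‖θ‖ ≤ S ∧ ‖a‖ ≤ 1 ∧ x = deriv (meanFn b) (inner ℝ a θ)}

/-- Assumptions on the mean function: continuously differentiable (part of `IsExpFamily`),
`k`-Lipschitz, `c_μ > 0`, and self-concordant, `|μ''| ≤ μ'`. -/
structure IsRegularMean (d : ℕ) (S : ℝ) (k : ℝ≥0) (b : ℝ → ℝ) : Prop where
  lipschitz : LipschitzWith k (meanFn b)
  cMu_pos : 0 < cMu d S b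
  differentiable_deriv : Differentiable ℝ (deriv (meanFn b))
  selfConcordant : ∀ x : ℝ, |deriv (deriv (meanFn b)) x| ≤ deriv (meanFn b) x

/-! ### The algorithm, along one trajectory of actions and rewards -/

/-- The rounds `s` with `max(1, t - τ) ≤ s ≤ t - 1`; the window length `τ` is a real number. -/
def window (τ : ℝ) (t : ℕ) : Finset ℕ :=
  (Finset.Ico 1 t).filter fun s => (t : ℝ) - τ ≤ (s : ℝ)

/-- The design matrix `V_t = ∑_{s in window} a_s a_sᵀ + (lam / c_μ) I`. -/
def designMatrix {d : ℕ} (lam cm τ : ℝ) (a : ℕ → Vec d) (t : ℕ) : Matrix (Fin d) (Fin d) ℝ :=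
  ∑ s ∈ window τ t, Matrix.vecMulVec (a s).ofLp (a s).ofLp
    + (lam / cm) • (1 : Matrix (Fin d) (Fin d) ℝ)

/-- `‖x‖_M = √(xᵀ M x)`. -/
def matNorm {d : ℕ} (M : Matrix (Fin d) (Fin d) ℝ) (x : Vec d) : ℝ :=
  Real.sqrt (x.ofLp ⬝ᵥ M.mulVec x.ofLp)

/-- The `ℓ²`-penalised log-likelihood of the observations in the window; the reward obtained by
playing `a s` is `r (s + 1)`. -/
def penLogLik {d : ℕ} (c b : ℝ → ℝ) (lam τ : ℝ) (a : ℕ → Vec d) (r : ℕ → ℝ) (t : ℕ)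
    (θ : Vec d) : ℝ :=
  ∑ s ∈ window τ t, logDensity c b (inner ℝ (a s) θ) (r (s + 1)) - lam / 2 * ‖θ‖ ^ 2

/-- The concentration radius `ρ_t^δ`. -/
def rho (d T : ℕ) (m k lam τ δ : ℝ) (t : ℕ) : ℝ :=
  Real.sqrt lam / (2 * m)
    + 2 * m / Real.sqrt lam * Real.log (T / δ)
    + d * m / Real.sqrt lam * Real.log (1 + k * min (t : ℝ) τ / (d * lam))
    + 2 * m / Real.sqrt lam * d * Real.log 2

/-- The exploration coefficient `β_t^δ`. -/
def beta (d T : ℕ) (S m k lam τ δ : ℝ) (t : ℕ) : ℝ :=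
  k * Real.sqrt lam *
    (1 + S + Real.sqrt ((1 + S) / lam) * rho d T m k lam τ δ t
      + (rho d T m k lam τ δ t / Real.sqrt lam) ^ 2) ^ (3 / 2 : ℝ)

/-- The upper confidence bound of action `x` at round `t`, for the estimate `θ`:
`μ(⟨x, θ⟩) + β_t^δ / √c_μ * ‖x‖_{V_t⁻¹}`. -/
def ucb {d : ℕ} (T : ℕ) (S m k lam τ δ : ℝ) (b : ℝ → ℝ) (a : ℕ → Vec d) (t : ℕ)
    (θ x : Vec d) : ℝ :=
  meanFn b (inner ℝ x θ)
    + beta d T S m k lam τ δ t / Real.sqrt (cMu d S b)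
      * matNorm (designMatrix lam (cMu d S b) τ a t)⁻¹ x

/-- The trajectory `(a, r)` is one that the algorithm SW-GLUCB may produce over `T` rounds when
it is offered the action sets `A`: at each round it computes the penalised maximum-likelihood
estimate over the window (the objective is strictly concave, so the estimate is unique) and plays
a maximiser of the upper confidence bound. -/
def IsSWGLUCB {d : ℕ} (T : ℕ) (S m k lam τ δ : ℝ) (c b : ℝ → ℝ)
    (A : ℕ → Set (Vec d)) (a : ℕ → Vec d) (r : ℕ → ℝ) : Prop :=
  ∀ t ∈ Finset.Icc 1 T, ∃ θhat : Vec d,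
    IsMaxOn (penLogLik c b lam τ a r t) Set.univ θhat ∧
    a t ∈ A t ∧
    IsMaxOn (ucb T S m k lam τ δ b a t θhat) (A t) (a t)

/-! ### The environment -/

/-- The number of rounds `2 ≤ t ≤ T` at which the parameter changes. -/
def numChanges {d : ℕ} (T : ℕ) (θs : ℕ → Vec d) : ℕ :=
  {t : ℕ | 2 ≤ t ∧ t ≤ T ∧ θs t ≠ θs (t - 1)}.ncard

/-- The largest mean reward `max_{x ∈ A} μ(⟨x, θ⟩)`. -/
def bestMean {d : ℕ} (b : ℝ → ℝ) (θ : Vec d) (A : Set (Vec d)) : ℝ :=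
  sSup ((fun x : Vec d => meanFn b (inner ℝ x θ)) '' A)

/-- The dynamic regret
`R_T = ∑_{t=1}^T (max_{x ∈ A_t} μ(⟨x, θ*_t⟩) - μ(⟨a_t, θ*_t⟩))` of a trajectory. -/
def regret {d : ℕ} (T : ℕ) (b : ℝ → ℝ) (θs : ℕ → Vec d) (A : ℕ → Set (Vec d))
    (a : ℕ → Vec d) : ℝ :=
  ∑ t ∈ Finset.Icc 1 T, (bestMean b (θs t) (A t) - meanFn b (inner ℝ (a t) (θs t)))

/-- Minimum gap: at every round every suboptimal action is suboptimal by at least `Δ`. -/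
def HasMinGap {d : ℕ} (T : ℕ) (b : ℝ → ℝ) (θs : ℕ → Vec d) (A : ℕ → Set (Vec d))
    (Δ : ℝ) : Prop :=
  ∀ t ∈ Finset.Icc 1 T, ∀ x ∈ A t,
    meanFn b (inner ℝ x (θs t)) < bestMean b (θs t) (A t) →
      Δ ≤ bestMean b (θs t) (A t) - meanFn b (inner ℝ x (θs t))

/-- Actions `a` and rewards `r` on a filtered probability space form an interaction with the
non-stationary generalized linear bandit with parameters `θs`: parameters have norm at most `S`,
available actions have norm at most `1`, the action `a_t` is chosen from the information `ℱ_t`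
available at round `t`, the reward `r_{t+1}` is then observed, given `ℱ_t` it has law
`P_{θ*_t}(· | a_t)`, and it lies in `[0, m]`. The action sets may be random. -/
structure IsInteraction {d : ℕ} {Ω : Type*} [mΩ : MeasurableSpace Ω] (P : Measure Ω)
    (ℱ : Filtration ℕ mΩ) (T : ℕ) (S m : ℝ) (ν : Measure ℝ) (c b : ℝ → ℝ) (θs : ℕ → Vec d)
    (A : ℕ → Ω → Set (Vec d)) (a : ℕ → Ω → Vec d) (r : ℕ → Ω → ℝ) : Prop where
  norm_param_le : ∀ t ∈ Finset.Icc 1 T, ‖θs t‖ ≤ S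
  norm_action_le : ∀ t ∈ Finset.Icc 1 T, ∀ ω, ∀ x ∈ A t ω, ‖x‖ ≤ 1
  action_mem : ∀ t ∈ Finset.Icc 1 T, ∀ ω, a t ω ∈ A t ω
  action_measurable : ∀ t ∈ Finset.Icc 1 T, Measurable[ℱ t] (a t)
  reward_measurable : ∀ t ∈ Finset.Icc 1 T, Measurable[ℱ (t + 1)] (r (t + 1))
  reward_law : ∀ t ∈ Finset.Icc 1 T, ∀ B : Set ℝ, MeasurableSet B →
    P⟦r (t + 1) ⁻¹' B | ℱ t⟧ =ᵐ[P]
      fun ω => (rewardLaw ν c b (inner ℝ (a t ω) (θs t))).real B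
  reward_bounded : ∀ t ∈ Finset.Icc 1 T, ∀ᵐ ω ∂P, r (t + 1) ω ∈ Set.Icc 0 m

end GLBandit

end

noncomputable section

namespace GLBandit

/-! ### Moments of a canonical exponential family -/

/-! The regret splits into rounds whose window contains a parameter other than the current one,
which are few, and rounds with a constant parameter, where optimism applies.

Concentration. In an exponential family the reward variance at natural parameter `η` is `μ'(η)`.
Since rewards lie in `[0, m]`, Bernstein's inequality makes `exp (⟨noise, ξ⟩ - Fisher form of ξ)`
have expectation at most `1` as soon as `‖ξ‖ m ≤ 1`. Averaging over `ξ` with a Gaussian weight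
truncated to the ball of radius `1 / m`, Markov's inequality at level `T / δ` and a union bound over
rounds (`IsInteraction.measure_exists_rho_lt_le`) bound the noise by `ρ_t` in the Fisher norm. The
mixture is bounded below by symmetry arguments (`inner_sub_form_le_log`), without computing a
Gaussian integral or a determinant.

Estimation. Self-concordance compares the Fisher form at the true parameter with the increment of
the gradient between the true parameter and the estimate, at the price of a factor `1 + ‖θhat - θ‖`.
The optimality condition evaluates this increment, and the resulting self-bounding inequality
controls the error with no projection of the estimate (`fisherForm_error_le`). The Fisher form sits
at the true parameter, so `c_μ` is lost only once, and the bonus dominates the prediction error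
(`abs_meanFn_sub_le_bonus`).

Regret. Optimism bounds the instantaneous regret `R` by twice the bonus. A nonzero `R` is at least
`Δ`, so `R ≤ R² / Δ`, and the squared bonuses sum to order `d² T / (c_μ τ)` up to logarithms, by the
elliptic potential lemma on blocks of length about `τ` (`sum_sq_matNorm_le`). Stale rounds number at
most `Γ (τ + 1)` (`card_staleRounds_le`). The prescribed `τ` balances the two: both are of order `Γ
τ = c_μ^{-1/2} d √(Γ T)`. -/

theorem rewardLaw_eq_withDensity {ν : Measure ℝ} {c b : ℝ → ℝ} (hf : IsExpFamily ν c b) (η : ℝ) :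
    rewardLaw ν c b η =
      (rewardLaw ν c b 0).withDensity
        fun r => ENNReal.ofReal (Real.exp (η * r) * Real.exp (b 0 - b η)) := by
  have hc := hf.measurable_c
  unfold rewardLaw logDensity
  rw [← withDensity_mul _ (by fun_prop) (by fun_prop)]
  congr 1
  ext r
  simp only [Pi.mul_apply]
  rw [← ENNReal.ofReal_mul (Real.exp_pos _).le, ← Real.exp_add, ← Real.exp_add]
  congr 2
  ring

theorem lintegral_exp_mul_rewardLaw_zero {ν : Measure ℝ} {c b : ℝ → ℝ} (hf : IsExpFamily ν c b)
    (η : ℝ) :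
    ∫⁻ r, ENNReal.ofReal (Real.exp (η * r)) ∂(rewardLaw ν c b 0) =
      ENNReal.ofReal (Real.exp (b η - b 0)) := by
  have h1 := (hf.isProbabilityMeasure η).measure_univ
  rw [rewardLaw_eq_withDensity hf η, withDensity_apply _ MeasurableSet.univ,
    Measure.restrict_univ] at h1
  simp_rw [ENNReal.ofReal_mul (Real.exp_pos _).le] at h1
  rw [lintegral_mul_const _ (by fun_prop)] at h1
  have h2 : ENNReal.ofReal (Real.exp (b 0 - b η)) * ENNReal.ofReal (Real.exp (b η - b 0)) = 1 := by
    rw [← ENNReal.ofReal_mul (Real.exp_pos _).le, ← Real.exp_add]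
    simp
  calc _ = (∫⁻ r, ENNReal.ofReal (Real.exp (η * r)) ∂(rewardLaw ν c b 0)) *
        (ENNReal.ofReal (Real.exp (b 0 - b η)) * ENNReal.ofReal (Real.exp (b η - b 0))) := by
        rw [h2, mul_one]
    _ = _ := by rw [← mul_assoc, h1, one_mul]

theorem integrable_exp_mul_rewardLaw_zero {ν : Measure ℝ} {c b : ℝ → ℝ} (hf : IsExpFamily ν c b)
    (η : ℝ) : Integrable (fun r => Real.exp (η * r)) (rewardLaw ν c b 0) := by
  refine ⟨by fun_prop, ?_⟩
  rw [hasFiniteIntegral_iff_ofReal (ae_of_all _ fun r => (Real.exp_pos _).le),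
    lintegral_exp_mul_rewardLaw_zero hf]
  exact ENNReal.ofReal_lt_top

theorem integral_exp_mul_rewardLaw_zero {ν : Measure ℝ} {c b : ℝ → ℝ} (hf : IsExpFamily ν c b)
    (η : ℝ) : ∫ r, Real.exp (η * r) ∂(rewardLaw ν c b 0) = Real.exp (b η - b 0) := by
  rw [integral_eq_lintegral_of_nonneg_ae (ae_of_all _ fun r => (Real.exp_pos _).le) (by fun_prop),
    lintegral_exp_mul_rewardLaw_zero hf, ENNReal.toReal_ofReal (Real.exp_pos _).le]

/-- The whole family consists of exponential tilts of its member at `0`, whose cumulant generating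
function is `b - b 0`. Mean and variance are then the first two derivatives of `b`. -/
theorem rewardLaw_eq_tilted {ν : Measure ℝ} {c b : ℝ → ℝ} (hf : IsExpFamily ν c b) (η : ℝ) :
    rewardLaw ν c b η = (rewardLaw ν c b 0).tilted (fun r => η * id r) := by
  rw [rewardLaw_eq_withDensity hf, Measure.tilted]
  simp only [id]
  rw [integral_exp_mul_rewardLaw_zero hf]
  congr 1
  ext r
  rw [div_eq_mul_inv, ← Real.exp_neg, neg_sub]

theorem cgf_rewardLaw_zero {ν : Measure ℝ} {c b : ℝ → ℝ} (hf : IsExpFamily ν c b) :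
    cgf id (rewardLaw ν c b 0) = fun η => b η - b 0 := by
  ext η
  rw [cgf, mgf]
  simp only [id]
  rw [integral_exp_mul_rewardLaw_zero hf, Real.log_exp]

theorem mem_interior_integrableExpSet {ν : Measure ℝ} {c b : ℝ → ℝ} (hf : IsExpFamily ν c b)
    (η : ℝ) : η ∈ interior (integrableExpSet id (rewardLaw ν c b 0)) := by
  have : integrableExpSet id (rewardLaw ν c b 0) = Set.univ :=
    Set.eq_univ_of_forall fun t => integrable_exp_mul_rewardLaw_zero hf t
  rw [this, interior_univ]
  trivial

theorem integral_id_rewardLaw {ν : Measure ℝ} {c b : ℝ → ℝ} (hf : IsExpFamily ν c b) (η : ℝ) :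
    ∫ r, r ∂(rewardLaw ν c b η) = meanFn b η := by
  have h := integral_tilted_mul_self (mem_interior_integrableExpSet hf η)
  rw [← rewardLaw_eq_tilted hf, cgf_rewardLaw_zero hf] at h
  simpa [meanFn] using h

theorem variance_id_rewardLaw {ν : Measure ℝ} {c b : ℝ → ℝ} (hf : IsExpFamily ν c b) (η : ℝ) :
    Var[id; rewardLaw ν c b η] = deriv (meanFn b) η := by
  have h := variance_tilted_mul (mem_interior_integrableExpSet hf η)
  rw [← rewardLaw_eq_tilted hf, cgf_rewardLaw_zero hf, iteratedDeriv_succ, iteratedDeriv_one] at h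
  rw [h]
  have : deriv (fun η => b η - b 0) = meanFn b := by
    ext x
    simp [meanFn]
  rw [this]

theorem rewardLaw_absolutelyContinuous {ν : Measure ℝ} {c b : ℝ → ℝ} (hf : IsExpFamily ν c b)
    (η η' : ℝ) : rewardLaw ν c b η ≪ rewardLaw ν c b η' := by
  rw [rewardLaw_eq_tilted hf η, rewardLaw_eq_tilted hf η']
  exact (tilted_absolutelyContinuous _ _).trans
    (absolutelyContinuous_tilted (integrable_exp_mul_rewardLaw_zero hf η'))

/-- Bernstein's bound on the moment generating function of a centred reward. -/
theorem lintegral_exp_centred_rewardLaw_le_one {ν : Measure ℝ} {c b : ℝ → ℝ} {m : ℝ}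
    (hf : IsExpFamily ν c b) {η u : ℝ}
    (hsupp : ∀ᵐ r ∂(rewardLaw ν c b η), r ∈ Set.Icc 0 m) (hu : |u| * m ≤ 1) :
    ∫⁻ r, ENNReal.ofReal
        (Real.exp (u * (r - meanFn b η) - u ^ 2 * deriv (meanFn b) η)) ∂(rewardLaw ν c b η) ≤ 1 := by
  have hP := hf.isProbabilityMeasure η
  set Q := rewardLaw ν c b η with hQ
  set M := meanFn b η with hM
  set V := deriv (meanFn b) η with hV
  have hmean : ∫ r, r ∂Q = M := integral_id_rewardLaw hf η
  have hint : Integrable (fun r : ℝ => r) Q :=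
    Integrable.of_mem_Icc 0 m aemeasurable_id hsupp
  have hM0 : 0 ≤ M := by
    rw [← hmean]
    exact integral_nonneg_of_ae (hsupp.mono fun r hr => hr.1)
  have hMm : M ≤ m := by
    rw [← hmean]
    calc ∫ r, r ∂Q ≤ ∫ _, m ∂Q := integral_mono_ae hint (integrable_const _)
          (hsupp.mono fun r hr => hr.2)
      _ = m := by simp
  have hvar : ∫ r, (r - M) ^ 2 ∂Q = V := by
    rw [hV, ← variance_id_rewardLaw hf η, variance_eq_integral aemeasurable_id]
    simp only [id, ← hQ, hmean]
  have hbd : ∀ᵐ r ∂Q, |r - M| ≤ m := hsupp.mono fun r hr => by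
    rw [abs_le]; constructor <;> linarith [hr.1, hr.2]
  have hint2 : Integrable (fun r : ℝ => (r - M) ^ 2) Q := by
    refine Integrable.of_mem_Icc 0 (m ^ 2) (by fun_prop) (hbd.mono fun r hr => ?_)
    exact ⟨sq_nonneg _, sq_le_sq.2 (hr.trans (le_abs_self m))⟩
  -- `e^x ≤ 1 + x + x²` for `|x| ≤ 1`; this is where `|u| m ≤ 1` is needed, and why the compensator
  -- is `u² V` rather than `u² V / 2`.
  have hpt : ∀ᵐ r ∂Q, Real.exp (u * (r - M)) ≤ 1 + u * (r - M) + u ^ 2 * (r - M) ^ 2 := by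
    filter_upwards [hbd] with r hr
    have h1 : |u * (r - M)| ≤ 1 := by
      rw [abs_mul]
      exact (mul_le_mul_of_nonneg_left hr (abs_nonneg _)).trans hu
    have h2 := (abs_le.1 (Real.abs_exp_sub_one_sub_id_le h1)).2
    rw [mul_pow] at h2
    linarith
  have hint3 : Integrable (fun r => 1 + u * (r - M) + u ^ 2 * (r - M) ^ 2) Q :=
    ((integrable_const _).add ((hint.sub (integrable_const _)).const_mul _)).add
      (hint2.const_mul _)
  have hint4 : Integrable (fun r => Real.exp (u * (r - M))) Q := by
    refine hint3.mono' (by fun_prop) (hpt.mono fun r hr => ?_)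
    rwa [Real.norm_eq_abs, abs_of_pos (Real.exp_pos _)]
  have hI : ∫ r, Real.exp (u * (r - M)) ∂Q ≤ Real.exp (u ^ 2 * V) := by
    calc _ ≤ ∫ r, (1 + u * (r - M) + u ^ 2 * (r - M) ^ 2) ∂Q := integral_mono_ae hint4 hint3 hpt
      _ = 1 + u ^ 2 * V := by
        have e1 : Integrable (fun r => u * (r - M)) Q :=
          (hint.sub (integrable_const _)).const_mul _
        have e2 : Integrable (fun r => 1 + u * (r - M)) Q := (integrable_const _).add e1
        rw [integral_add e2 (hint2.const_mul _), integral_add (integrable_const _) e1,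
          integral_const_mul, integral_const_mul, integral_sub hint (integrable_const _), hvar,
          hmean]
        simp
      _ ≤ _ := by linarith [Real.add_one_le_exp (u ^ 2 * V)]
  have hint5 : Integrable (fun r => Real.exp (u * (r - M) - u ^ 2 * V)) Q := by
    simp_rw [Real.exp_sub]
    exact hint4.div_const _
  rw [← ofReal_integral_eq_lintegral_ofReal hint5 (ae_of_all _ fun r => (Real.exp_pos _).le)]
  rw [ENNReal.ofReal_le_one]
  simp_rw [Real.exp_sub]
  rw [integral_div, div_le_one (Real.exp_pos _)]
  exact hI

/-! ### Disintegration along the conditional reward law -/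

theorem measurable_rewardLaw {ν : Measure ℝ} {c b : ℝ → ℝ} (hf : IsExpFamily ν c b) :
    Measurable (rewardLaw ν c b) := by
  have hP := hf.isProbabilityMeasure 0
  have hb : Continuous b := hf.contDiff_b.continuous
  refine Measure.measurable_of_measurable_coe _ fun B hB => ?_
  have : (fun η => rewardLaw ν c b η B) = fun η => ∫⁻ r, ENNReal.ofReal
      (Real.exp (η * r) * Real.exp (b 0 - b η)) ∂((rewardLaw ν c b 0).restrict B) := by
    ext η
    rw [rewardLaw_eq_withDensity hf η, withDensity_apply _ hB]
  rw [this]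
  refine Measurable.lintegral_prod_right' (f := fun p : ℝ × ℝ => ENNReal.ofReal
      (Real.exp (p.1 * p.2) * Real.exp (b 0 - b p.1))) ?_
  have := hb.measurable
  fun_prop

/-- The joint law of `(Y, r)` is the law of `Y` composed with the reward kernel. It suffices to
check this on rectangles, where it is the defining property of conditional probability. This is what
allows the latest reward to be integrated out with the past frozen. -/
theorem lintegral_eq_of_conditional_rewardLaw {Ω 𝒴 : Type*} {m₀ : MeasurableSpace Ω}
    [mΩ : MeasurableSpace Ω] [MeasurableSpace 𝒴] {P : Measure Ω} [IsProbabilityMeasure P]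
    (hm : m₀ ≤ mΩ) {ν : Measure ℝ} {c b : ℝ → ℝ} (hf : IsExpFamily ν c b) {Y : Ω → 𝒴}
    (hY : Measurable[m₀] Y) {r : Ω → ℝ} (hr : Measurable r) {g : 𝒴 → ℝ} (hg : Measurable g)
    (hlaw : ∀ B : Set ℝ, MeasurableSet B →
      P⟦r ⁻¹' B | m₀⟧ =ᵐ[P] fun ω => (rewardLaw ν c b (g (Y ω))).real B)
    {F : 𝒴 × ℝ → ℝ≥0∞} (hF : Measurable F) :
    ∫⁻ ω, F (Y ω, r ω) ∂P = ∫⁻ ω, ∫⁻ x, F (Y ω, x) ∂(rewardLaw ν c b (g (Y ω))) ∂P := by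
  have hY' : Measurable Y := hY.mono hm le_rfl
  let κ : Kernel 𝒴 ℝ := ⟨fun y => rewardLaw ν c b (g y), (measurable_rewardLaw hf).comp hg⟩
  have hκ : IsMarkovKernel κ := ⟨fun y => hf.isProbabilityMeasure (g y)⟩
  have hκa : ∀ y, κ y = rewardLaw ν c b (g y) := fun _ => rfl
  have hPY : IsProbabilityMeasure (P.map Y) := Measure.isProbabilityMeasure_map hY'.aemeasurable
  have key : P.map (fun ω => (Y ω, r ω)) = (P.map Y) ⊗ₘ κ := by
    refine Measure.ext_prod fun {s B} hs hB => ?_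
    rw [Measure.map_apply (hY'.prodMk hr) (hs.prod hB), Measure.compProd_apply_prod hs hB,
      setLIntegral_map hs (κ.measurable_coe hB) hY']
    have hset : (fun ω => (Y ω, r ω)) ⁻¹' (s ×ˢ B) = Y ⁻¹' s ∩ r ⁻¹' B := rfl
    have hint : Integrable ((r ⁻¹' B).indicator fun _ => (1 : ℝ)) P :=
      (integrable_const _).indicator (hr hB)
    have h1 := setIntegral_condExp hm hint (hY hs)
    rw [setIntegral_congr_ae (g := fun ω => (rewardLaw ν c b (g (Y ω))).real B) (hY' hs)
      ((hlaw B hB).mono fun ω h _ => h), integral_indicator_const _ (hr hB),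
      measureReal_restrict_apply (hr hB), smul_eq_mul, mul_one] at h1
    rw [hset, Set.inter_comm, ← ofReal_measureReal, ← h1, ofReal_integral_eq_lintegral_ofReal]
    · refine lintegral_congr fun ω => ?_
      have := hf.isProbabilityMeasure (g (Y ω))
      rw [hκa, ofReal_measureReal]
    · refine (Integrable.of_mem_Icc 0 1 ?_ (ae_of_all _ fun ω => ?_)).integrableOn
      · exact (((κ.measurable_coe hB).comp hY').ennreal_toReal).aemeasurable
      · have := hf.isProbabilityMeasure (g (Y ω))
        exact ⟨measureReal_nonneg, measureReal_le_one⟩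
    · exact ae_of_all _ fun ω => measureReal_nonneg
  calc ∫⁻ ω, F (Y ω, r ω) ∂P = ∫⁻ p, F p ∂(P.map (fun ω => (Y ω, r ω))) := by
        rw [lintegral_map hF (hY'.prodMk hr)]
    _ = ∫⁻ y, ∫⁻ x, F (y, x) ∂(κ y) ∂(P.map Y) := by
        rw [key, Measure.lintegral_compProd hF]
    _ = _ := by
        rw [lintegral_map (Measurable.lintegral_kernel_prod_right' hF) hY']
        rfl

/-- Only observed rewards are assumed bounded. Disintegrating the first reward yields some `ω` at
which its law is carried by `[0, m]`; all members of the family are mutually absolutely continuous,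
so the support bound passes to every `η`. -/
theorem ae_rewardLaw_mem_Icc {d : ℕ} {Ω : Type*} [mΩ : MeasurableSpace Ω] {P : Measure Ω}
    [IsProbabilityMeasure P] {ℱ : Filtration ℕ mΩ} {T : ℕ} {S m : ℝ} {ν : Measure ℝ}
    {c b : ℝ → ℝ} {θs : ℕ → Vec d} {A : ℕ → Ω → Set (Vec d)} {a : ℕ → Ω → Vec d}
    {r : ℕ → Ω → ℝ} (hf : IsExpFamily ν c b) (hI : IsInteraction P ℱ T S m ν c b θs A a r)
    (hT : 1 ≤ T) (η : ℝ) : ∀ᵐ x ∂(rewardLaw ν c b η), x ∈ Set.Icc 0 m := by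
  have ht : 1 ∈ Finset.Icc 1 T := Finset.mem_Icc.2 ⟨le_rfl, hT⟩
  have hB : MeasurableSet (Set.Icc 0 m)ᶜ := measurableSet_Icc.compl
  have h := lintegral_eq_of_conditional_rewardLaw (ℱ.le 1) hf (hI.action_measurable 1 ht)
    ((hI.reward_measurable 1 ht).mono (ℱ.le 2) le_rfl) (g := fun y => inner ℝ y (θs 1))
    (by fun_prop) (hI.reward_law 1 ht)
    (F := fun p => (Set.Icc 0 m)ᶜ.indicator (fun _ => 1) p.2)
    ((measurable_const.indicator hB).comp measurable_snd)
  have h0 : ∫⁻ ω, (Set.Icc 0 m)ᶜ.indicator (fun _ => (1 : ℝ≥0∞)) (r (1 + 1) ω) ∂P = 0 := by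
    rw [← lintegral_zero (μ := P)]
    refine lintegral_congr_ae ?_
    filter_upwards [hI.reward_bounded 1 ht] with ω hω
    simp [hω.1, hω.2]
  simp only at h
  rw [h0] at h
  simp_rw [lintegral_indicator_const hB, one_mul] at h
  have hη : ∃ ω, rewardLaw ν c b (inner ℝ (a 1 ω) (θs 1)) (Set.Icc 0 m)ᶜ = 0 := by
    by_contra! hne
    have hpos : 0 < ∫⁻ ω, rewardLaw ν c b (inner ℝ (a 1 ω) (θs 1)) (Set.Icc 0 m)ᶜ ∂P := by
      rw [lintegral_pos_iff_support]
      · have : Function.support (fun ω =>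
            rewardLaw ν c b (inner ℝ (a 1 ω) (θs 1)) (Set.Icc 0 m)ᶜ) = Set.univ :=
          Set.eq_univ_of_forall hne
        rw [this, measure_univ]
        exact one_pos
      · have ha := (hI.action_measurable 1 ht).mono (ℱ.le 1) le_rfl
        exact (Measure.measurable_coe hB).comp ((measurable_rewardLaw hf).comp (by fun_prop))
    exact hpos.ne h
  obtain ⟨ω, hω⟩ := hη
  exact (rewardLaw_absolutelyContinuous hf η _) hω

/-! ### The exponential supermartingale -/

/-- The noise `ε_{s+1} = r_{s+1} - μ(⟨a_s, θ*_s⟩)` of the reward observed after round `s`. -/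
def noise {d : ℕ} (b : ℝ → ℝ) (θs a : ℕ → Vec d) (r : ℕ → ℝ) (s : ℕ) : ℝ :=
  r (s + 1) - meanFn b (inner ℝ (a s) (θs s))

/-- The noise vector `∑ ε_{s+1} a_s` over the window. -/
def noiseVec {d : ℕ} (b : ℝ → ℝ) (τ : ℝ) (θs a : ℕ → Vec d) (r : ℕ → ℝ) (t : ℕ) : Vec d :=
  ∑ s ∈ window τ t, noise b θs a r s • a s

/-- The quadratic form `∑ μ'(⟨a_s, θ*_s⟩) ⟨a_s, ξ⟩²` over the window. -/
def fisherForm {d : ℕ} (b : ℝ → ℝ) (τ : ℝ) (θs a : ℕ → Vec d) (t : ℕ) (ξ : Vec d) : ℝ :=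
  ∑ s ∈ window τ t, deriv (meanFn b) (inner ℝ (a s) (θs s)) * inner ℝ (a s) ξ ^ 2

/-- The logarithm of the factor contributed by round `s` to the supermartingale of direction
`ξ`. -/
def logFactor {d : ℕ} (b : ℝ → ℝ) (θs a : ℕ → Vec d) (r : ℕ → ℝ) (ξ : Vec d) (s : ℕ) : ℝ :=
  inner ℝ (a s) ξ * noise b θs a r s
    - inner ℝ (a s) ξ ^ 2 * deriv (meanFn b) (inner ℝ (a s) (θs s))

theorem sum_logFactor_window {d : ℕ} (b : ℝ → ℝ) (τ : ℝ) (θs a : ℕ → Vec d) (r : ℕ → ℝ) (t : ℕ)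
    (ξ : Vec d) : ∑ s ∈ window τ t, logFactor b θs a r ξ s =
      inner ℝ (noiseVec b τ θs a r t) ξ - fisherForm b τ θs a t ξ := by
  simp only [logFactor, noiseVec, fisherForm, sum_inner, ← Finset.sum_sub_distrib,
    real_inner_smul_left]
  exact Finset.sum_congr rfl fun s _ => by ring

theorem measurable_meanFn (b : ℝ → ℝ) : Measurable (meanFn b) := measurable_deriv b

section

variable {d : ℕ} {Ω : Type*} [mΩ : MeasurableSpace Ω] {P : Measure Ω}
  {ℱ : Filtration ℕ mΩ} {T : ℕ} {S m : ℝ} {ν : Measure ℝ} {c b : ℝ → ℝ} {θs : ℕ → Vec d}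
  {A : ℕ → Ω → Set (Vec d)} {a : ℕ → Ω → Vec d} {r : ℕ → Ω → ℝ}

theorem IsInteraction.norm_le_one (hI : IsInteraction P ℱ T S m ν c b θs A a r) {t : ℕ}
    (ht : t ∈ Finset.Icc 1 T) (ω : Ω) : ‖a t ω‖ ≤ 1 :=
  hI.norm_action_le t ht ω _ (hI.action_mem t ht ω)

theorem IsInteraction.measurable_logFactor (hI : IsInteraction P ℱ T S m ν c b θs A a r)
    (ξ : Vec d) {s n : ℕ} (hs : s ∈ Finset.Icc 1 T) (hsn : s < n) :
    Measurable[ℱ n] fun ω => logFactor b θs (fun t => a t ω) (fun t => r t ω) ξ s := by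
  have h1 : Measurable[ℱ n] (a s) := (hI.action_measurable s hs).mono (ℱ.mono hsn.le) le_rfl
  have h2 : Measurable[ℱ n] (r (s + 1)) := (hI.reward_measurable s hs).mono (ℱ.mono hsn) le_rfl
  have h3 := measurable_meanFn b
  have h4 : Measurable (deriv (meanFn b)) := measurable_deriv _
  unfold logFactor noise
  fun_prop

/-- The predicate `p` selects the rounds of a window: for a fixed `t` the window is deterministic,
so omitted rounds contribute a factor `1` and the product remains a supermartingale. -/
theorem IsInteraction.lintegral_exp_sum_logFactor_le_one [IsProbabilityMeasure P]
    (hf : IsExpFamily ν c b)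
    (hI : IsInteraction P ℱ T S m ν c b θs A a r) (hT : 1 ≤ T) (hm : 0 ≤ m) {ξ : Vec d}
    (hξ : ‖ξ‖ * m ≤ 1) (p : ℕ → Prop) [DecidablePred p] (n : ℕ) (hn : n ≤ T + 1) :
    ∫⁻ ω, ENNReal.ofReal (Real.exp (∑ s ∈ (Finset.Ico 1 n).filter p,
      logFactor b θs (fun t => a t ω) (fun t => r t ω) ξ s)) ∂P ≤ 1 := by
  induction n with
  | zero => simp
  | succ n ih =>
    rcases Nat.eq_zero_or_pos n with rfl | hn0
    · simp
    have hnT : n ∈ Finset.Icc 1 T := Finset.mem_Icc.2 ⟨hn0, by omega⟩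
    specialize ih (by omega)
    rw [← Finset.insert_Ico_right_eq_Ico_add_one hn0, Finset.filter_insert]
    split_ifs with hp
    swap
    · exact ih
    set W : Ω → ℝ := fun ω => ∑ s ∈ (Finset.Ico 1 n).filter p,
      logFactor b θs (fun t => a t ω) (fun t => r t ω) ξ s with hW
    have hWm : Measurable[ℱ n] W := by
      refine Finset.measurable_fun_sum _ fun s hs => ?_
      have hs' := Finset.mem_Ico.1 (Finset.mem_filter.1 hs).1
      exact hI.measurable_logFactor ξ (Finset.mem_Icc.2 ⟨hs'.1, by omega⟩) hs'.2
    have h3 := measurable_meanFn b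
    have h4 : Measurable (deriv (meanFn b)) := measurable_deriv _
    let F : (ℝ × Vec d) × ℝ → ℝ≥0∞ := fun q => ENNReal.ofReal (Real.exp q.1.1) *
      ENNReal.ofReal (Real.exp (inner ℝ q.1.2 ξ * (q.2 - meanFn b (inner ℝ q.1.2 (θs n)))
        - inner ℝ q.1.2 ξ ^ 2 * deriv (meanFn b) (inner ℝ q.1.2 (θs n))))
    have hF : Measurable F := by fun_prop
    have key := lintegral_eq_of_conditional_rewardLaw (P := P) (ℱ.le n) hf
      (hWm.prodMk (hI.action_measurable n hnT))
      ((hI.reward_measurable n hnT).mono (ℱ.le (n + 1)) le_rfl)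
      (g := fun y => inner ℝ y.2 (θs n)) (by fun_prop) (hI.reward_law n hnT) hF
    calc _ = ∫⁻ ω, F ((W ω, a n ω), r (n + 1) ω) ∂P := by
          refine lintegral_congr fun ω => ?_
          rw [Finset.sum_insert (by simp), add_comm, Real.exp_add,
            ENNReal.ofReal_mul (Real.exp_pos _).le]
          rfl
      _ = _ := key
      -- The factor of round `n` has conditional expectation at most `1` by the Bernstein bound,
      -- with `u = ⟨a_n, ξ⟩` and `|u| ≤ ‖ξ‖`.
      _ ≤ ∫⁻ ω, ENNReal.ofReal (Real.exp (W ω)) ∂P := by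
          refine lintegral_mono fun ω => ?_
          simp only [F]
          rw [lintegral_const_mul _ (by fun_prop)]
          refine mul_le_of_le_one_right (zero_le) ?_
          refine lintegral_exp_centred_rewardLaw_le_one hf (ae_rewardLaw_mem_Icc hf hI hT _) ?_
          refine le_trans (mul_le_mul_of_nonneg_right ?_ hm) hξ
          calc |inner ℝ (a n ω) ξ| ≤ ‖a n ω‖ * ‖ξ‖ := abs_real_inner_le_norm _ _
            _ ≤ ‖ξ‖ := mul_le_of_le_one_left (norm_nonneg _) (hI.norm_le_one hnT ω)
      _ ≤ 1 := ih

theorem IsInteraction.lintegral_exp_noiseVec_le_one [IsProbabilityMeasure P]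
    (hf : IsExpFamily ν c b)
    (hI : IsInteraction P ℱ T S m ν c b θs A a r) (hT : 1 ≤ T) (hm : 0 ≤ m) {ξ : Vec d}
    (hξ : ‖ξ‖ * m ≤ 1) (τ : ℝ) (t : ℕ) (ht : t ≤ T + 1) :
    ∫⁻ ω, ENNReal.ofReal (Real.exp
      (inner ℝ (noiseVec b τ θs (fun t => a t ω) (fun t => r t ω) t) ξ
        - fisherForm b τ θs (fun t => a t ω) t ξ)) ∂P ≤ 1 := by
  simp_rw [← sum_logFactor_window]
  exact hI.lintegral_exp_sum_logFactor_le_one hf hT hm hξ _ t ht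

end

/-! ### A lower bound for truncated Gaussian mixtures -/

section

variable {d : ℕ}

theorem integrableOn_closedBall_of_continuous {f : Vec d → ℝ} (hf : Continuous f) (x : Vec d)
    (R : ℝ) : IntegrableOn f (Metric.closedBall x R) :=
  hf.continuousOn.integrableOn_compact (isCompact_closedBall _ _)

theorem setIntegral_closedBall_comp_isometry (e : Vec d ≃ₗᵢ[ℝ] Vec d) (f : Vec d → ℝ) (R : ℝ) :
    ∫ u in Metric.closedBall (0 : Vec d) R, f (e u) = ∫ u in Metric.closedBall (0 : Vec d) R, f u := by
  have h := e.measurePreserving.setIntegral_preimage_emb e.toHomeomorph.measurableEmbedding f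
    (Metric.closedBall 0 R)
  rwa [e.preimage_closedBall, map_zero] at h

theorem setIntegral_inner_mul_radial_eq_zero (φ : ℝ → ℝ) (L : Vec d) (R : ℝ) :
    ∫ u in Metric.closedBall (0 : Vec d) R, inner ℝ L u * φ ‖u‖ = 0 := by
  have h := setIntegral_closedBall_comp_isometry (LinearIsometryEquiv.neg ℝ)
    (fun u : Vec d => inner ℝ L u * φ ‖u‖) R
  have h2 : ∀ u : Vec d, inner ℝ L (LinearIsometryEquiv.neg ℝ u) *
      φ ‖LinearIsometryEquiv.neg ℝ u‖ = -(inner ℝ L u * φ ‖u‖) := fun u => by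
    rw [LinearIsometryEquiv.norm_map, LinearIsometryEquiv.coe_neg, inner_neg_right, neg_mul]
  rw [integral_congr_ae (ae_of_all _ h2), integral_neg] at h
  linarith

theorem setIntegral_inner_sq_mul_radial_congr (φ : ℝ → ℝ) {x y : Vec d} (hxy : ‖x‖ = ‖y‖) (R : ℝ) :
    ∫ u in Metric.closedBall (0 : Vec d) R, inner ℝ x u ^ 2 * φ ‖u‖ =
      ∫ u in Metric.closedBall (0 : Vec d) R, inner ℝ y u ^ 2 * φ ‖u‖ := by
  -- Reflection in the hyperplane orthogonal to `x - y` exchanges `x` and `y`, since they have equal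
  -- norms.
  rw [← setIntegral_closedBall_comp_isometry (Submodule.reflection (Submodule.span ℝ {x - y})ᗮ)
    (fun u : Vec d => inner ℝ y u ^ 2 * φ ‖u‖) R]
  refine setIntegral_congr_fun Metric.isClosed_closedBall.measurableSet fun u _ => ?_
  have h := LinearIsometryEquiv.inner_map_map
    (Submodule.reflection (Submodule.span ℝ {x - y})ᗮ) x u
  rw [Submodule.reflection_sub hxy] at h
  rw [h, LinearIsometryEquiv.norm_map]

/-- The second moments of a rotation-invariant density are isotropic. -/
theorem setIntegral_inner_sq_mul_radial {φ : ℝ → ℝ} (hφ : Continuous φ) (x : Vec d) (R : ℝ) :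
    d * ∫ u in Metric.closedBall (0 : Vec d) R, inner ℝ x u ^ 2 * φ ‖u‖ =
      ‖x‖ ^ 2 * ∫ u in Metric.closedBall (0 : Vec d) R, ‖u‖ ^ 2 * φ ‖u‖ := by
  -- `x` may be replaced by `‖x‖ e_i` for any `i`; summing over `i` turns the coordinate squares
  -- into `‖u‖²`.
  have h1 : ∀ i : Fin d, ∫ u in Metric.closedBall (0 : Vec d) R, inner ℝ x u ^ 2 * φ ‖u‖ =
      ‖x‖ ^ 2 * ∫ u in Metric.closedBall (0 : Vec d) R, u i ^ 2 * φ ‖u‖ := by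
    intro i
    rw [setIntegral_inner_sq_mul_radial_congr φ
      (y := ‖x‖ • EuclideanSpace.single i (1 : ℝ)) (by simp [norm_smul]), ← integral_const_mul]
    refine integral_congr_ae (ae_of_all _ fun u => ?_)
    simp only [real_inner_smul_left, EuclideanSpace.inner_single_left, map_one, one_mul]
    ring
  calc _ = ∑ _i : Fin d, ∫ u in Metric.closedBall (0 : Vec d) R, inner ℝ x u ^ 2 * φ ‖u‖ := by simp
    _ = ∑ i : Fin d, ‖x‖ ^ 2 * ∫ u in Metric.closedBall (0 : Vec d) R, u i ^ 2 * φ ‖u‖ :=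
        Finset.sum_congr rfl fun i _ => h1 i
    _ = _ := by
        rw [← Finset.mul_sum, ← integral_finsetSum]
        · congr 1
          refine integral_congr_ae (ae_of_all _ fun u => ?_)
          simp only [← Finset.sum_mul, EuclideanSpace.norm_sq_eq, Real.norm_eq_abs, sq_abs]
        · exact fun i _ => integrableOn_closedBall_of_continuous (by fun_prop) _ _

theorem setIntegral_closedBall_comp_add_smul (f : Vec d → ℝ) (x : Vec d) {s : ℝ} (hs : 0 < s)
    {R : ℝ} (hR : 0 ≤ R) :
    ∫ v in Metric.closedBall x (s * R), f v =
      s ^ d * ∫ u in Metric.closedBall (0 : Vec d) R, f (x + s • u) := by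
  have h1 := Measure.setIntegral_comp_smul_of_pos (volume : Measure (Vec d)) (fun v => f (x + v))
    (Metric.closedBall 0 R) hs
  have h2 := (measurePreserving_add_left (volume : Measure (Vec d)) x).setIntegral_preimage_emb
    (measurableEmbedding_addLeft x) f (Metric.closedBall x (s * R))
  have h3 : (fun v => x + v) ⁻¹' Metric.closedBall x (s * R) = Metric.closedBall 0 (s * R) := by
    ext v; simp
  rw [h3] at h2
  rw [smul_closedBall _ _ hR, smul_zero, Real.norm_of_nonneg hs.le, h2, smul_eq_mul,
    finrank_euclideanSpace_fin] at h1
  rw [h1, mul_inv_cancel_left₀ (pow_ne_zero _ hs.ne')]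

/-- Contracting by `2` only increases the weight, so doubling the radius costs at most the Jacobian
`2 ^ d`. This is the origin of the `d log 2` term in `rho`. -/
theorem setIntegral_gaussian_two_mul_le {lam : ℝ} (hlam : 0 ≤ lam) {R : ℝ} (hR : 0 ≤ R) :
    ∫ u in Metric.closedBall (0 : Vec d) (2 * R), Real.exp (-(lam * ‖u‖ ^ 2)) ≤
      2 ^ d * ∫ u in Metric.closedBall (0 : Vec d) R, Real.exp (-(lam * ‖u‖ ^ 2)) := by
  rw [setIntegral_closedBall_comp_add_smul _ _ two_pos hR]
  refine mul_le_mul_of_nonneg_left ?_ (by positivity)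
  refine setIntegral_mono (integrableOn_closedBall_of_continuous (by fun_prop) _ _)
    (integrableOn_closedBall_of_continuous (by fun_prop) _ _) fun u => ?_
  simp only [zero_add, norm_smul, Real.norm_ofNat]
  rw [Real.exp_le_exp]
  nlinarith [mul_nonneg hlam (sq_nonneg ‖u‖)]

theorem setIntegral_gaussian_pos {lam : ℝ} {R : ℝ} (hR : 0 < R) :
    0 < ∫ u in Metric.closedBall (0 : Vec d) R, Real.exp (-(lam * ‖u‖ ^ 2)) := by
  rw [setIntegral_pos_iff_support_of_nonneg_ae (ae_of_all _ fun u => (Real.exp_pos _).le)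
    (integrableOn_closedBall_of_continuous (by fun_prop) _ _)]
  have : Function.support (fun u : Vec d => Real.exp (-(lam * ‖u‖ ^ 2))) = Set.univ :=
    Set.eq_univ_of_forall fun u => (Real.exp_pos _).ne'
  rw [this, Set.univ_inter]
  exact Metric.measure_closedBall_pos _ _ hR

/-- The ball of radius `s R` about `ξ₀` lies inside the ball of radius `2 R`; substitute `ξ = ξ₀ + s
u` there and use `e^x ≥ 1 + x`. Against the radial weight the linear term vanishes and the quadratic
form averages to at most `K / d` times `‖u‖²`. The factor `s ^ d` plays the role of the determinant
in the usual Gaussian mixture. -/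
theorem le_setIntegral_exp_inner_sub_form {ι : Type*} (I : Finset ι) (σ : ι → ℝ) (x : ι → Vec d)
    (hσ : ∀ i ∈ I, 0 ≤ σ i) (hx : ∀ i ∈ I, ‖x i‖ ≤ 1) {K : ℝ} (hK : ∑ i ∈ I, σ i ≤ K)
    (hd : 1 ≤ d) {lam R s : ℝ} (hR : 0 < R) (hs : 0 < s) (hs1 : s ≤ 1)
    (hsK : s ^ 2 * (lam + K / d) = lam) (v ξ₀ : Vec d) (hξ₀ : ‖ξ₀‖ ≤ R) :
    s ^ d * (Real.exp (inner ℝ v ξ₀ - ∑ i ∈ I, σ i * inner ℝ (x i) ξ₀ ^ 2 - lam * ‖ξ₀‖ ^ 2) *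
        ∫ u in Metric.closedBall (0 : Vec d) R, Real.exp (-(lam * ‖u‖ ^ 2))) ≤
      ∫ ξ in Metric.closedBall (0 : Vec d) (2 * R),
        Real.exp (inner ℝ v ξ - ∑ i ∈ I, σ i * inner ℝ (x i) ξ ^ 2) *
          Real.exp (-(lam * ‖ξ‖ ^ 2)) := by
  have hd0 : (0 : ℝ) < d := by exact_mod_cast hd
  set f : Vec d → ℝ := fun ξ => Real.exp (inner ℝ v ξ - ∑ i ∈ I, σ i * inner ℝ (x i) ξ ^ 2) *
          Real.exp (-(lam * ‖ξ‖ ^ 2)) with hf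
  have hfc : Continuous f := by fun_prop
  have hsub : Metric.closedBall ξ₀ (s * R) ⊆ Metric.closedBall 0 (2 * R) := by
    refine Metric.closedBall_subset_closedBall' ?_
    rw [dist_zero_right]
    nlinarith
  have h1 : ∫ ξ in Metric.closedBall ξ₀ (s * R), f ξ ≤ ∫ ξ in Metric.closedBall 0 (2 * R), f ξ :=
    setIntegral_mono_set (integrableOn_closedBall_of_continuous hfc _ _)
      (ae_of_all _ fun u => by positivity) hsub.eventuallyLE
  refine le_trans ?_ h1
  rw [setIntegral_closedBall_comp_add_smul f ξ₀ hs hR.le]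
  refine mul_le_mul_of_nonneg_left ?_ (by positivity)
  set g₀ := inner ℝ v ξ₀ - ∑ i ∈ I, σ i * inner ℝ (x i) ξ₀ ^ 2 - lam * ‖ξ₀‖ ^ 2 with hg₀
  -- `s` times the gradient at `ξ₀` of the exponent, penalty included.
  set L : Vec d := s • (v - ∑ i ∈ I, (2 * σ i * inner ℝ (x i) ξ₀) • x i - (2 * lam) • ξ₀) with hL
  set w : ℝ → ℝ := fun ρ => Real.exp (-(lam * ρ ^ 2)) with hw
  have hwc : Continuous w := by fun_prop
  set q : Vec d → ℝ := fun u => ∑ i ∈ I, σ i * inner ℝ (x i) u ^ 2 with hq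
  have hfe : ∀ u, f (ξ₀ + s • u) = Real.exp g₀ *
      (Real.exp (inner ℝ L u - s ^ 2 * q u + lam * (1 - s ^ 2) * ‖u‖ ^ 2) * w ‖u‖) := by
    intro u
    simp only [hf, hw]
    rw [← Real.exp_add, ← Real.exp_add, ← Real.exp_add]
    congr 1
    have e1 : ‖ξ₀ + s • u‖ ^ 2 = ‖ξ₀‖ ^ 2 + 2 * s * inner ℝ ξ₀ u + s ^ 2 * ‖u‖ ^ 2 := by
      rw [norm_add_sq_real, real_inner_smul_right, norm_smul, mul_pow, Real.norm_eq_abs, sq_abs]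
      ring
    have e2 : ∑ i ∈ I, σ i * inner ℝ (x i) (ξ₀ + s • u) ^ 2 =
        ∑ i ∈ I, σ i * inner ℝ (x i) ξ₀ ^ 2
          + s * ∑ i ∈ I, 2 * σ i * inner ℝ (x i) ξ₀ * inner ℝ (x i) u + s ^ 2 * q u := by
      simp only [hq, Finset.mul_sum, ← Finset.sum_add_distrib, inner_add_right,
        real_inner_smul_right]
      exact Finset.sum_congr rfl fun i _ => by ring
    have e3 : inner ℝ L u = s * (inner ℝ v u
        - ∑ i ∈ I, 2 * σ i * inner ℝ (x i) ξ₀ * inner ℝ (x i) u - 2 * lam * inner ℝ ξ₀ u) := by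
      simp only [hL, real_inner_smul_left, inner_sub_left, sum_inner]
    rw [e1, e2, e3, hg₀, inner_add_right, real_inner_smul_right]
    ring
  simp_rw [hfe]
  rw [integral_const_mul]
  refine mul_le_mul_of_nonneg_left ?_ (Real.exp_pos _).le
  have hi : ∀ {φ : Vec d → ℝ}, Continuous φ → IntegrableOn φ (Metric.closedBall 0 R) :=
    fun h => integrableOn_closedBall_of_continuous h _ _
  set M := ∫ u in Metric.closedBall (0 : Vec d) R, ‖u‖ ^ 2 * w ‖u‖ with hM
  have hM0 : 0 ≤ M := integral_nonneg fun u => by positivity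
  have hqM : ∫ u in Metric.closedBall (0 : Vec d) R, q u * w ‖u‖ ≤ K / d * M := by
    simp only [hq, Finset.sum_mul]
    rw [integral_finsetSum _ fun i _ => hi (by fun_prop)]
    have : ∀ i ∈ I, ∫ u in Metric.closedBall (0 : Vec d) R, σ i * inner ℝ (x i) u ^ 2 * w ‖u‖ ≤
        σ i * (M / d) := by
      intro i hi'
      simp_rw [mul_assoc]
      rw [integral_const_mul]
      refine mul_le_mul_of_nonneg_left ?_ (hσ i hi')
      rw [le_div_iff₀' hd0, setIntegral_inner_sq_mul_radial hwc]
      exact mul_le_of_le_one_left hM0 (pow_le_one₀ (norm_nonneg _) (hx i hi'))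
    refine (Finset.sum_le_sum this).trans ?_
    rw [← Finset.sum_mul, div_mul_eq_mul_div, ← mul_div_assoc]
    gcongr
  have hlow : ∫ u in Metric.closedBall (0 : Vec d) R,
      (w ‖u‖ + inner ℝ L u * w ‖u‖ - s ^ 2 * (q u * w ‖u‖)
        + lam * (1 - s ^ 2) * (‖u‖ ^ 2 * w ‖u‖)) ≤
      ∫ u in Metric.closedBall (0 : Vec d) R,
        Real.exp (inner ℝ L u - s ^ 2 * q u + lam * (1 - s ^ 2) * ‖u‖ ^ 2) * w ‖u‖ := by
    refine setIntegral_mono (hi (by fun_prop)) (hi (by fun_prop)) fun u => ?_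
    have h := Real.add_one_le_exp (inner ℝ L u - s ^ 2 * q u + lam * (1 - s ^ 2) * ‖u‖ ^ 2)
    have h2 := mul_le_mul_of_nonneg_right h (Real.exp_pos (-(lam * ‖u‖ ^ 2))).le
    refine le_trans (le_of_eq ?_) h2
    simp only [hw]
    ring
  refine le_trans ?_ hlow
  rw [integral_add (hi (by fun_prop)) (hi (by fun_prop)),
    integral_sub (hi (by fun_prop)) (hi (by fun_prop)),
    integral_add (hi (by fun_prop)) (hi (by fun_prop)), integral_const_mul, integral_const_mul,
    setIntegral_inner_mul_radial_eq_zero w L R, ← hM]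
  have h5 := mul_le_mul_of_nonneg_left hqM (sq_nonneg s)
  -- This is the equation defining `s`: the gain from the rescaled penalty offsets the mean of the
  -- quadratic form.
  have h6 : lam * (1 - s ^ 2) = s ^ 2 * (K / d) := by linarith
  rw [h6]
  linarith

theorem inner_sub_form_le_log {ι : Type*} (I : Finset ι) (σ : ι → ℝ) (x : ι → Vec d)
    (hσ : ∀ i ∈ I, 0 ≤ σ i) (hx : ∀ i ∈ I, ‖x i‖ ≤ 1) {K : ℝ} (hK : ∑ i ∈ I, σ i ≤ K)
    (hd : 1 ≤ d) {lam R X : ℝ} (hlam : 0 < lam) (hR : 0 < R) (hX : 0 < X) (v : Vec d)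
    (h : ∫ ξ in Metric.closedBall (0 : Vec d) (2 * R),
        Real.exp (inner ℝ v ξ - ∑ i ∈ I, σ i * inner ℝ (x i) ξ ^ 2) *
          Real.exp (-(lam * ‖ξ‖ ^ 2)) ≤
      X * ∫ u in Metric.closedBall (0 : Vec d) (2 * R), Real.exp (-(lam * ‖u‖ ^ 2)))
    {ξ₀ : Vec d} (hξ₀ : ‖ξ₀‖ ≤ R) :
    inner ℝ v ξ₀ - ∑ i ∈ I, σ i * inner ℝ (x i) ξ₀ ^ 2 - lam * ‖ξ₀‖ ^ 2 ≤
      Real.log X + d * Real.log 2 + d / 2 * Real.log (1 + K / (d * lam)) := by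
  have hd0 : (0 : ℝ) < d := by exact_mod_cast hd
  have hK0 : 0 ≤ K := (Finset.sum_nonneg hσ).trans hK
  set Y := 1 + K / (d * lam) with hY
  have hY1 : 1 ≤ Y := by
    have : 0 ≤ K / (d * lam) := by positivity
    linarith
  have hY0 : 0 < Y := by linarith
  -- The solution of `s² (lam + K / d) = lam`; the logarithm of `s ^ d` gives the term `d / 2 * log
  -- Y`.
  set s := (Real.sqrt Y)⁻¹ with hs
  have hsq : 0 < Real.sqrt Y := Real.sqrt_pos.2 hY0
  have hs0 : 0 < s := inv_pos.2 hsq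
  have hs1 : s ≤ 1 := inv_le_one_of_one_le₀ (Real.one_le_sqrt.2 hY1)
  have hs2 : s ^ 2 * (lam + K / d) = lam := by
    rw [hs, inv_pow, Real.sq_sqrt hY0.le, inv_mul_eq_iff_eq_mul₀ hY0.ne', hY]
    field_simp
  have h1 := le_setIntegral_exp_inner_sub_form I σ x hσ hx hK hd hR hs0 hs1 hs2 v ξ₀ hξ₀
  have h2 := setIntegral_gaussian_two_mul_le (d := d) hlam.le hR.le
  have hN := setIntegral_gaussian_pos (d := d) (lam := lam) hR
  set N := ∫ u in Metric.closedBall (0 : Vec d) R, Real.exp (-(lam * ‖u‖ ^ 2))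
  set g := inner ℝ v ξ₀ - ∑ i ∈ I, σ i * inner ℝ (x i) ξ₀ ^ 2 - lam * ‖ξ₀‖ ^ 2
  have h3 : s ^ d * Real.exp g * N ≤ X * 2 ^ d * N := by
    calc s ^ d * Real.exp g * N = s ^ d * (Real.exp g * N) := by ring
      _ ≤ _ := h1
      _ ≤ _ := h
      _ ≤ X * (2 ^ d * N) := mul_le_mul_of_nonneg_left h2 hX.le
      _ = _ := by ring
  have h4 : s ^ d * Real.exp g ≤ X * 2 ^ d := le_of_mul_le_mul_right h3 hN
  have h5 := Real.log_le_log (by positivity) h4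
  rw [Real.log_mul (by positivity) (Real.exp_pos _).ne', Real.log_exp,
    Real.log_mul hX.ne' (by positivity), Real.log_pow, Real.log_pow, hs, Real.log_inv,
    Real.log_sqrt hY0.le] at h5
  linarith

end

/-! ### Concentration of the noise vector -/

theorem IsRegularMean.deriv_nonneg {d : ℕ} {S : ℝ} {k : ℝ≥0} {b : ℝ → ℝ}
    (hb : IsRegularMean d S k b) (x : ℝ) : 0 ≤ deriv (meanFn b) x :=
  (abs_nonneg _).trans (hb.selfConcordant x)

theorem IsRegularMean.deriv_le {d : ℕ} {S : ℝ} {k : ℝ≥0} {b : ℝ → ℝ}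
    (hb : IsRegularMean d S k b) (x : ℝ) : deriv (meanFn b) x ≤ k :=
  (le_abs_self _).trans (norm_deriv_le_of_lipschitz hb.lipschitz)

theorem card_window_le {τ : ℝ} (hτ : 0 ≤ τ) (t : ℕ) : ((window τ t).card : ℝ) ≤ min (t : ℝ) τ := by
  refine le_min ?_ ?_
  · have : (window τ t).card ≤ (Finset.Ico 1 t).card := Finset.card_filter_le _ _
    rw [Nat.card_Ico] at this
    exact_mod_cast this.trans (Nat.sub_le _ _)
  · have hsub : window τ t ⊆ Finset.Ico (t - ⌊τ⌋₊) t := by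
      intro s hs
      obtain ⟨hs1, hs2⟩ := Finset.mem_filter.1 hs
      rw [Finset.mem_Ico] at hs1 ⊢
      refine ⟨?_, hs1.2⟩
      have : t - s ≤ ⌊τ⌋₊ := Nat.le_floor (by rw [Nat.cast_sub hs1.2.le]; linarith)
      omega
    have h := Finset.card_le_card hsub
    rw [Nat.card_Ico] at h
    have h2 : (window τ t).card ≤ ⌊τ⌋₊ := by omega
    exact le_trans (by exact_mod_cast h2) (Nat.floor_le hτ)

theorem fisherForm_smul {d : ℕ} (b : ℝ → ℝ) (τ : ℝ) (θs a : ℕ → Vec d) (t : ℕ) (x : ℝ) (ξ : Vec d) :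
    fisherForm b τ θs a t (x • ξ) = x ^ 2 * fisherForm b τ θs a t ξ := by
  simp only [fisherForm, Finset.mul_sum, real_inner_smul_right]
  exact Finset.sum_congr rfl fun s _ => by ring

theorem fisherForm_nonneg {d : ℕ} {S : ℝ} {k : ℝ≥0} {b : ℝ → ℝ} (hb : IsRegularMean d S k b)
    (τ : ℝ) (θs a : ℕ → Vec d) (t : ℕ) (ξ : Vec d) : 0 ≤ fisherForm b τ θs a t ξ :=
  Finset.sum_nonneg fun _ _ => mul_nonneg (hb.deriv_nonneg _) (sq_nonneg _)

/-- A bound on the exponential mixture over the ball of radius `1 / m` gives the self-normalised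
bound of radius `ρ_t`. -/
theorem inner_noiseVec_le_rho {d : ℕ} {S : ℝ} {k : ℝ≥0} {b : ℝ → ℝ} (hb : IsRegularMean d S k b)
    (hd : 1 ≤ d) {T : ℕ} {m lam τ δ : ℝ} (hm : 0 < m) (hlam : 0 < lam) (hτ : 0 ≤ τ)
    (hTδ : 0 < T / δ) {θs a : ℕ → Vec d} {r : ℕ → ℝ} {t : ℕ} (ha : ∀ s ∈ window τ t, ‖a s‖ ≤ 1)
    (h : ∫ ξ in Metric.closedBall (0 : Vec d) m⁻¹,
        Real.exp (inner ℝ (noiseVec b τ θs a r t) ξ - fisherForm b τ θs a t ξ) *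
          Real.exp (-(lam * ‖ξ‖ ^ 2)) ≤
      T / δ * ∫ u in Metric.closedBall (0 : Vec d) m⁻¹, Real.exp (-(lam * ‖u‖ ^ 2))) (ξ : Vec d) :
    inner ℝ (noiseVec b τ θs a r t) ξ ≤
      rho d T m k lam τ δ t * Real.sqrt (fisherForm b τ θs a t ξ + lam * ‖ξ‖ ^ 2) := by
  have hK : ∑ s ∈ window τ t, deriv (meanFn b) (inner ℝ (a s) (θs s)) ≤ k * min (t : ℝ) τ := by
    calc _ ≤ ∑ s ∈ window τ t, (k : ℝ) := Finset.sum_le_sum fun s _ => hb.deriv_le _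
      _ = k * (window τ t).card := by rw [Finset.sum_const, nsmul_eq_mul, mul_comm]
      _ ≤ _ := mul_le_mul_of_nonneg_left (card_window_le hτ t) k.coe_nonneg
  -- Half the radius of the mixture ball, leaving room for the translated ball around `ξ₀`.
  set R := 1 / (2 * m) with hR
  have hR0 : 0 < R := by positivity
  have h2R : m⁻¹ = 2 * R := by rw [hR]; field_simp
  rw [h2R] at h
  have hq := fisherForm_nonneg hb τ θs a t ξ
  set Q := fisherForm b τ θs a t ξ + lam * ‖ξ‖ ^ 2 with hQ
  set v := noiseVec b τ θs a r t with hv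
  rcases eq_or_ne ξ 0 with rfl | hξ
  · simp [hQ, fisherForm]
  have hξn : 0 < ‖ξ‖ := norm_pos_iff.2 hξ
  have hQ0 : 0 < Q := by positivity
  have hsQ := Real.sqrt_pos.2 hQ0
  have hsl := Real.sqrt_pos.2 hlam
  have hle : Real.sqrt lam * ‖ξ‖ ≤ Real.sqrt Q := by
    refine Real.le_sqrt_of_sq_le ?_
    rw [mul_pow, Real.sq_sqrt hlam.le]
    linarith
  -- The scale is chosen so that `x² Q = lam R²`, a quantity independent of `ξ`; then `√lam ‖ξ‖ ≤
  -- √Q` forces `‖x • ξ‖ ≤ R`. Dividing by `x` produces exactly `rho * √Q`.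
  set x := Real.sqrt lam * R / Real.sqrt Q with hx
  have hx0 : 0 < x := by positivity
  have hξ₀ : ‖x • ξ‖ ≤ R := by
    rw [norm_smul, Real.norm_of_nonneg hx0.le, hx, div_mul_eq_mul_div, div_le_iff₀ hsQ]
    nlinarith
  have key := inner_sub_form_le_log (window τ t)
    (fun s => deriv (meanFn b) (inner ℝ (a s) (θs s))) a (fun s _ => hb.deriv_nonneg _) ha hK hd
    hlam hR0 hTδ v h hξ₀
  have hform : ∑ i ∈ window τ t, deriv (meanFn b) (inner ℝ (a i) (θs i)) * inner ℝ (a i) (x • ξ) ^ 2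
      = x ^ 2 * fisherForm b τ θs a t ξ := fisherForm_smul b τ θs a t x ξ
  have hxQ : x ^ 2 * Q = lam * R ^ 2 := by
    rw [hx, div_pow, mul_pow, Real.sq_sqrt hlam.le, Real.sq_sqrt hQ0.le]
    field_simp
  set B := Real.log (T / δ) + d * Real.log 2 + d / 2 * Real.log (1 + k * min (t : ℝ) τ / (d * lam))
    with hB
  have h1 : x * inner ℝ v ξ ≤ B + lam * R ^ 2 := by
    rw [real_inner_smul_right, hform, norm_smul, mul_pow, Real.norm_of_nonneg hx0.le] at key
    rw [← hxQ, hQ]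
    linarith
  have h2 : inner ℝ v ξ ≤ (B + lam * R ^ 2) / x := by rwa [le_div_iff₀' hx0]
  refine h2.trans (le_of_eq ?_)
  rw [rho, hx, hB, hR]
  have hl2 : lam = Real.sqrt lam * Real.sqrt lam := (Real.mul_self_sqrt hlam.le).symm
  generalize Real.log (1 + k * min (t : ℝ) τ / (d * lam)) = l1
  generalize Real.log (T / δ) = l2
  generalize Real.log 2 = l3
  generalize Real.sqrt lam = sl at hl2 hsl
  rw [hl2]
  field_simp
  ring

section

variable {d : ℕ} {Ω : Type*} [mΩ : MeasurableSpace Ω] {P : Measure Ω}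
  {ℱ : Filtration ℕ mΩ} {T : ℕ} {S m : ℝ} {ν : Measure ℝ} {c b : ℝ → ℝ} {θs : ℕ → Vec d}
  {A : ℕ → Ω → Set (Vec d)} {a : ℕ → Ω → Vec d} {r : ℕ → Ω → ℝ}

theorem window_subset_Icc {τ : ℝ} {t : ℕ} (ht : t ≤ T + 1) : window τ t ⊆ Finset.Icc 1 T := by
  intro s hs
  have := Finset.mem_Ico.1 (Finset.mem_filter.1 hs).1
  exact Finset.mem_Icc.2 ⟨this.1, by omega⟩

theorem IsInteraction.measurable_inner_noiseVec_sub_fisherForm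
    (hI : IsInteraction P ℱ T S m ν c b θs A a r) (τ : ℝ) {t : ℕ} (ht : t ≤ T + 1) :
    Measurable fun p : Ω × Vec d =>
      inner ℝ (noiseVec b τ θs (fun t => a t p.1) (fun t => r t p.1) t) p.2
        - fisherForm b τ θs (fun t => a t p.1) t p.2 := by
  simp_rw [← sum_logFactor_window]
  refine Finset.measurable_fun_sum _ fun s hs => ?_
  have hs' := window_subset_Icc ht hs
  have h1 : Measurable (a s) := (hI.action_measurable s hs').mono (ℱ.le s) le_rfl
  have h2 : Measurable (r (s + 1)) := (hI.reward_measurable s hs').mono (ℱ.le _) le_rfl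
  have h3 := measurable_meanFn b
  have h4 : Measurable (deriv (meanFn b)) := measurable_deriv _
  unfold logFactor noise
  fun_prop

/-- Method of mixtures: by Tonelli the mixture has expectation at most the mass `N` of the truncated
Gaussian weight, and on the bad event it is at least `(T / δ) N`, so Markov's inequality gives `δ /
T`. -/
theorem IsInteraction.measure_rho_lt_le [IsProbabilityMeasure P] {k : ℝ≥0}
    (hf : IsExpFamily ν c b) (hb : IsRegularMean d S k b)
    (hI : IsInteraction P ℱ T S m ν c b θs A a r) (hd : 1 ≤ d) (hm : 0 < m) {lam τ δ : ℝ}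
    (hlam : 0 < lam) (hτ : 0 ≤ τ) (hδ : 0 < δ) {t : ℕ} (ht : t ∈ Finset.Icc 1 T) :
    P {ω | ¬ ∀ ξ : Vec d,
        inner ℝ (noiseVec b τ θs (fun t => a t ω) (fun t => r t ω) t) ξ ≤ rho d T m k lam τ δ t *
          Real.sqrt (fisherForm b τ θs (fun t => a t ω) t ξ + lam * ‖ξ‖ ^ 2)} ≤
      ENNReal.ofReal (δ / T) := by
  obtain ⟨ht1, htT⟩ := Finset.mem_Icc.1 ht
  have hT0 : (0 : ℝ) < T := by exact_mod_cast (by omega : 0 < T)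
  set Bl := Metric.closedBall (0 : Vec d) m⁻¹ with hBl
  set w : Vec d → ℝ := fun ξ => Real.exp (-(lam * ‖ξ‖ ^ 2)) with hw
  obtain ⟨G, hG⟩ : ∃ G : Ω → Vec d → ℝ, ∀ ω ξ, G ω ξ =
    inner ℝ (noiseVec b τ θs (fun t => a t ω) (fun t => r t ω) t) ξ
      - fisherForm b τ θs (fun t => a t ω) t ξ := ⟨_, fun _ _ => rfl⟩
  have hGm : Measurable fun p : Ω × Vec d => G p.1 p.2 := by
    simp_rw [hG]
    exact hI.measurable_inner_noiseVec_sub_fisherForm τ (by omega)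
  have hGc : ∀ ω, Continuous (G ω) := fun ω => by
    rw [funext (hG ω)]
    simp only [fisherForm]
    fun_prop
  have hG1 : ∀ ξ : Vec d, ‖ξ‖ * m ≤ 1 → ∫⁻ ω, ENNReal.ofReal (Real.exp (G ω ξ)) ∂P ≤ 1 := by
    intro ξ hξ
    simp_rw [hG]
    exact hI.lintegral_exp_noiseVec_le_one hf (by omega) hm.le hξ τ t (by omega)
  have hwc : Continuous w := by fun_prop
  set f : Ω → Vec d → ℝ≥0∞ := fun ω ξ =>
    ENNReal.ofReal (Real.exp (G ω ξ)) * ENNReal.ofReal (w ξ) with hfdef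
  have hfm : Measurable fun p : Ω × Vec d => f p.1 p.2 := by fun_prop
  set N := ∫ ξ in Bl, w ξ with hN
  have hN0 : 0 < N := setIntegral_gaussian_pos (by positivity)
  have hNl : ∫⁻ ξ in Bl, ENNReal.ofReal (w ξ) = ENNReal.ofReal N := by
    rw [hN, ofReal_integral_eq_lintegral_ofReal
      (integrableOn_closedBall_of_continuous hwc _ _) (ae_of_all _ fun _ => (Real.exp_pos _).le)]
  have hE : ∫⁻ ω, (∫⁻ ξ in Bl, f ω ξ) ∂P ≤ ENNReal.ofReal N := by
    rw [lintegral_lintegral_swap hfm.aemeasurable, ← hNl]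
    refine setLIntegral_mono (by fun_prop) fun ξ hξ => ?_
    simp only [hfdef]
    have hξ' : ‖ξ‖ * m ≤ 1 := by
      rw [hBl, mem_closedBall_zero_iff] at hξ
      calc ‖ξ‖ * m ≤ m⁻¹ * m := mul_le_mul_of_nonneg_right hξ hm.le
        _ = 1 := inv_mul_cancel₀ hm.ne'
    have hGξ : Measurable fun ω => G ω ξ := hGm.comp (measurable_id.prodMk measurable_const)
    rw [lintegral_mul_const _ (by fun_prop)]
    exact mul_le_of_le_one_left zero_le (hG1 ξ hξ')
  have hsub : {ω | ¬ ∀ ξ : Vec d,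
        inner ℝ (noiseVec b τ θs (fun t => a t ω) (fun t => r t ω) t) ξ ≤ rho d T m k lam τ δ t *
          Real.sqrt (fisherForm b τ θs (fun t => a t ω) t ξ + lam * ‖ξ‖ ^ 2)} ⊆
      {ω | ENNReal.ofReal (T / δ * N) ≤ ∫⁻ ξ in Bl, f ω ξ} := by
    intro ω hω
    by_contra hlt
    refine hω (inner_noiseVec_le_rho hb hd hm hlam hτ (by positivity)
      (fun s hs => hI.norm_le_one (window_subset_Icc (by omega) hs) ω) ?_)
    simp_rw [← hG]
    rw [Set.mem_ofPred_eq, not_le] at hlt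
    have hc : Continuous fun ξ => Real.exp (G ω ξ) * w ξ := by fun_prop
    have h1 : ∫⁻ ξ in Bl, f ω ξ = ENNReal.ofReal (∫ ξ in Bl, Real.exp (G ω ξ) * w ξ) := by
      rw [ofReal_integral_eq_lintegral_ofReal
        (integrableOn_closedBall_of_continuous hc _ _) (ae_of_all _ fun _ => by positivity)]
      refine lintegral_congr fun ξ => ?_
      rw [ENNReal.ofReal_mul (Real.exp_pos _).le]
    rw [h1] at hlt
    exact (ENNReal.ofReal_lt_ofReal_iff (by positivity)).1 hlt |>.le
  refine (measure_mono hsub).trans ?_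
  have hmarkov := meas_ge_le_lintegral_div (μ := P) (f := fun ω => ∫⁻ ξ in Bl, f ω ξ)
    (Measurable.lintegral_prod_right' hfm).aemeasurable (ε := ENNReal.ofReal (T / δ * N))
    (by rw [Ne, ENNReal.ofReal_eq_zero, not_le]; positivity) ENNReal.ofReal_ne_top
  refine hmarkov.trans ((ENNReal.div_le_div_right hE _).trans ?_)
  rw [← ENNReal.ofReal_div_of_pos (by positivity)]
  refine ENNReal.ofReal_le_ofReal (le_of_eq ?_)
  field_simp

/-- With probability at least `1 - δ` the self-normalised bound holds in all rounds. -/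
theorem IsInteraction.measure_exists_rho_lt_le [IsProbabilityMeasure P] {k : ℝ≥0}
    (hf : IsExpFamily ν c b) (hb : IsRegularMean d S k b)
    (hI : IsInteraction P ℱ T S m ν c b θs A a r) (hd : 1 ≤ d) (hm : 0 < m) {lam τ δ : ℝ}
    (hlam : 0 < lam) (hτ : 0 ≤ τ) (hδ : 0 < δ) (hT : 1 ≤ T) :
    P {ω | ¬ ∀ t ∈ Finset.Icc 1 T, ∀ ξ : Vec d,
        inner ℝ (noiseVec b τ θs (fun t => a t ω) (fun t => r t ω) t) ξ ≤ rho d T m k lam τ δ t *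
          Real.sqrt (fisherForm b τ θs (fun t => a t ω) t ξ + lam * ‖ξ‖ ^ 2)} ≤
      ENNReal.ofReal δ := by
  have hT0 : (0 : ℝ) < T := by exact_mod_cast hT
  set E : ℕ → Set Ω := fun t => {ω | ¬ ∀ ξ : Vec d,
        inner ℝ (noiseVec b τ θs (fun t => a t ω) (fun t => r t ω) t) ξ ≤ rho d T m k lam τ δ t *
          Real.sqrt (fisherForm b τ θs (fun t => a t ω) t ξ + lam * ‖ξ‖ ^ 2)} with hE
  have hsub : {ω | ¬ ∀ t ∈ Finset.Icc 1 T, ∀ ξ : Vec d,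
        inner ℝ (noiseVec b τ θs (fun t => a t ω) (fun t => r t ω) t) ξ ≤ rho d T m k lam τ δ t *
          Real.sqrt (fisherForm b τ θs (fun t => a t ω) t ξ + lam * ‖ξ‖ ^ 2)} ⊆
      ⋃ t ∈ Finset.Icc 1 T, E t := by
    intro ω hω
    rw [Set.mem_ofPred_eq] at hω
    push Not at hω
    obtain ⟨t, ht, ξ, hξ⟩ := hω
    simp only [Set.mem_iUnion]
    exact ⟨t, ht, fun h => (h ξ).not_gt hξ⟩
  calc _ ≤ P (⋃ t ∈ Finset.Icc 1 T, E t) := measure_mono hsub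
    _ ≤ ∑ t ∈ Finset.Icc 1 T, P (E t) := measure_biUnion_finset_le _ _
    _ ≤ ∑ t ∈ Finset.Icc 1 T, ENNReal.ofReal (δ / T) :=
        Finset.sum_le_sum fun t ht => hI.measure_rho_lt_le hf hb hd hm hlam hτ hδ ht
    _ = ENNReal.ofReal δ := by
        rw [Finset.sum_const, Nat.card_Icc, Nat.add_sub_cancel, nsmul_eq_mul,
          ← ENNReal.ofReal_natCast, ← ENNReal.ofReal_mul hT0.le, mul_div_cancel₀ _ hT0.ne']

end

/-! ### Regularised Gram matrices and the elliptic potential -/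

section

variable {d : ℕ}

/-- `∑_{s ∈ I} x_s x_sᵀ + κ I`. -/
def gramMatrix (κ : ℝ) (I : Finset ℕ) (x : ℕ → Fin d → ℝ) : Matrix (Fin d) (Fin d) ℝ :=
  ∑ s ∈ I, Matrix.vecMulVec (x s) (x s) + κ • (1 : Matrix (Fin d) (Fin d) ℝ)

theorem designMatrix_eq_gramMatrix (lam cm τ : ℝ) (a : ℕ → Vec d) (t : ℕ) :
    designMatrix lam cm τ a t = gramMatrix (lam / cm) (window τ t) fun s => (a s).ofLp := rfl

theorem gramMatrix_mulVec (κ : ℝ) (I : Finset ℕ) (x : ℕ → Fin d → ℝ) (z : Fin d → ℝ) :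
    (gramMatrix κ I x).mulVec z = ∑ s ∈ I, (x s ⬝ᵥ z) • x s + κ • z := by
  rw [gramMatrix, Matrix.add_mulVec, Matrix.sum_mulVec, Matrix.smul_mulVec, Matrix.one_mulVec]
  congr 1
  refine Finset.sum_congr rfl fun s _ => ?_
  rw [Matrix.vecMulVec_mulVec]
  ext i
  simp [mul_comm]

theorem dotProduct_gramMatrix_mulVec (κ : ℝ) (I : Finset ℕ) (x : ℕ → Fin d → ℝ) (y z : Fin d → ℝ) :
    y ⬝ᵥ (gramMatrix κ I x).mulVec z = ∑ s ∈ I, (x s ⬝ᵥ y) * (x s ⬝ᵥ z) + κ * (y ⬝ᵥ z) := by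
  rw [gramMatrix_mulVec, dotProduct_add, dotProduct_sum, dotProduct_smul, smul_eq_mul]
  congr 1
  refine Finset.sum_congr rfl fun s _ => ?_
  rw [dotProduct_smul, smul_eq_mul, mul_comm, dotProduct_comm y]

theorem posDef_gramMatrix {κ : ℝ} (hκ : 0 < κ) (I : Finset ℕ) (x : ℕ → Fin d → ℝ) :
    (gramMatrix κ I x).PosDef := by
  refine Matrix.PosDef.posSemidef_add ?_ (Matrix.PosDef.one.smul hκ)
  exact Matrix.posSemidef_sum I fun s _ => Matrix.posSemidef_vecMulVec_self_star (x s)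

theorem gramMatrix_mulVec_inv_mulVec {κ : ℝ} (hκ : 0 < κ) (I : Finset ℕ) (x : ℕ → Fin d → ℝ)
    (y : Fin d → ℝ) : (gramMatrix κ I x).mulVec ((gramMatrix κ I x)⁻¹.mulVec y) = y := by
  rw [Matrix.mulVec_mulVec, Matrix.mul_nonsing_inv _ (posDef_gramMatrix hκ I x).det_pos.ne'.isUnit,
    Matrix.one_mulVec]

theorem dotProduct_gramMatrix_mulVec_comm (κ : ℝ) (I : Finset ℕ) (x : ℕ → Fin d → ℝ)
    (y z : Fin d → ℝ) :
    y ⬝ᵥ (gramMatrix κ I x).mulVec z = z ⬝ᵥ (gramMatrix κ I x).mulVec y := by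
  rw [dotProduct_gramMatrix_mulVec, dotProduct_gramMatrix_mulVec, dotProduct_comm y z]
  simp_rw [mul_comm]

theorem dotProduct_gramMatrix_mulVec_self_nonneg {κ : ℝ} (hκ : 0 ≤ κ) (I : Finset ℕ)
    (x : ℕ → Fin d → ℝ) (y : Fin d → ℝ) : 0 ≤ y ⬝ᵥ (gramMatrix κ I x).mulVec y := by
  rw [dotProduct_gramMatrix_mulVec]
  have : 0 ≤ y ⬝ᵥ y := Finset.sum_nonneg fun i _ => mul_self_nonneg _
  exact add_nonneg (Finset.sum_nonneg fun i _ => mul_self_nonneg _) (mul_nonneg hκ this)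

theorem dotProduct_gramMatrix_inv_mulVec_nonneg {κ : ℝ} (hκ : 0 < κ) (I : Finset ℕ)
    (x : ℕ → Fin d → ℝ) (y : Fin d → ℝ) : 0 ≤ y ⬝ᵥ (gramMatrix κ I x)⁻¹.mulVec y := by
  have h := dotProduct_gramMatrix_mulVec_self_nonneg hκ.le I x ((gramMatrix κ I x)⁻¹.mulVec y)
  rwa [gramMatrix_mulVec_inv_mulVec hκ, dotProduct_comm] at h

/-- The Cauchy-Schwarz inequality for the norms of a Gram matrix and of its inverse. -/
theorem sq_dotProduct_le_gramMatrix {κ : ℝ} (hκ : 0 < κ) (I : Finset ℕ) (x : ℕ → Fin d → ℝ)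
    (y z : Fin d → ℝ) :
    (y ⬝ᵥ z) ^ 2 ≤ (y ⬝ᵥ (gramMatrix κ I x)⁻¹.mulVec y) * (z ⬝ᵥ (gramMatrix κ I x).mulVec z) := by
  set G := gramMatrix κ I x with hG
  set w := G⁻¹.mulVec y with hw
  have hGw : G.mulVec w = y := gramMatrix_mulVec_inv_mulVec hκ I x y
  have h : ∀ t : ℝ, 0 ≤ (y ⬝ᵥ w) * (t * t) + (-2 * (y ⬝ᵥ z)) * t + z ⬝ᵥ G.mulVec z := by
    intro t
    have h1 := dotProduct_gramMatrix_mulVec_self_nonneg hκ.le I x (z - t • w)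
    rw [← hG, Matrix.mulVec_sub, Matrix.mulVec_smul, hGw, dotProduct_sub, sub_dotProduct,
      sub_dotProduct, smul_dotProduct, dotProduct_smul, dotProduct_smul, smul_dotProduct,
      dotProduct_gramMatrix_mulVec_comm κ I x w z, ← hG, hGw] at h1
    rw [dotProduct_comm z y, dotProduct_comm w y] at h1
    simp only [smul_eq_mul] at h1
    linarith
  have h2 := discrim_le_zero h
  rw [discrim] at h2
  nlinarith

/-- Cauchy-Schwarz tested at `w = G_J⁻¹ y` gives `⟨y, w⟩² ≤ (yᵀ G_I⁻¹ y) (wᵀ G_I w)`, and `wᵀ G_I w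
≤ wᵀ G_J w = ⟨y, w⟩`; one factor cancels. -/
theorem gramMatrix_inv_antitone {κ : ℝ} (hκ : 0 < κ) {I J : Finset ℕ} (hIJ : I ⊆ J)
    (x : ℕ → Fin d → ℝ) (y : Fin d → ℝ) :
    y ⬝ᵥ (gramMatrix κ J x)⁻¹.mulVec y ≤ y ⬝ᵥ (gramMatrix κ I x)⁻¹.mulVec y := by
  set w := (gramMatrix κ J x)⁻¹.mulVec y with hw
  have h1 := sq_dotProduct_le_gramMatrix hκ I x y w
  have h2 : w ⬝ᵥ (gramMatrix κ I x).mulVec w ≤ w ⬝ᵥ (gramMatrix κ J x).mulVec w := by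
    rw [dotProduct_gramMatrix_mulVec, dotProduct_gramMatrix_mulVec]
    gcongr
    exact fun s _ _ => mul_self_nonneg _
  rw [gramMatrix_mulVec_inv_mulVec hκ, dotProduct_comm w y] at h2
  have h3 := dotProduct_gramMatrix_inv_mulVec_nonneg hκ I x y
  have h4 : 0 ≤ y ⬝ᵥ w := dotProduct_gramMatrix_inv_mulVec_nonneg hκ J x y
  rcases h4.eq_or_lt with h0 | hpos
  · rw [← h0]; exact h3
  · have h5 : (y ⬝ᵥ w) * (y ⬝ᵥ w) ≤
        (y ⬝ᵥ (gramMatrix κ I x)⁻¹.mulVec y) * (y ⬝ᵥ w) := by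
      rw [← sq]
      exact h1.trans (mul_le_mul_of_nonneg_left h2 h3)
    exact le_of_mul_le_mul_right h5 hpos

theorem dotProduct_gramMatrix_inv_mulVec_le {κ : ℝ} (hκ : 0 < κ) (I : Finset ℕ)
    (x : ℕ → Fin d → ℝ) (y : Fin d → ℝ) :
    y ⬝ᵥ (gramMatrix κ I x)⁻¹.mulVec y ≤ (y ⬝ᵥ y) / κ := by
  refine (gramMatrix_inv_antitone hκ (Finset.empty_subset I) x y).trans (le_of_eq ?_)
  have h := gramMatrix_mulVec_inv_mulVec hκ ∅ x y
  nth_rewrite 1 [gramMatrix_mulVec] at h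
  rw [Finset.sum_empty, zero_add] at h
  rw [eq_div_iff hκ.ne', mul_comm, ← smul_eq_mul, ← dotProduct_smul, h]

theorem det_gramMatrix_insert {κ : ℝ} (hκ : 0 < κ) {I : Finset ℕ} {n : ℕ} (hn : n ∉ I)
    (x : ℕ → Fin d → ℝ) :
    (gramMatrix κ (insert n I) x).det =
      (gramMatrix κ I x).det * (1 + x n ⬝ᵥ (gramMatrix κ I x)⁻¹.mulVec (x n)) := by
  have h1 : gramMatrix κ (insert n I) x = gramMatrix κ I x
      + Matrix.replicateCol Unit (x n) * Matrix.replicateRow Unit (x n) := by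
    rw [gramMatrix, gramMatrix, Finset.sum_insert hn, ← Matrix.vecMulVec_eq]
    abel
  rw [h1, Matrix.det_add_replicateCol_mul_replicateRow
    (posDef_gramMatrix hκ I x).det_pos.ne'.isUnit, Matrix.mul_assoc,
    ← Matrix.replicateCol_mulVec, Matrix.det_unique (n := Unit), Matrix.add_apply,
    Matrix.one_apply_eq, Matrix.replicateRow_mul_replicateCol_apply]

/-- Each eigenvalue is the value of the quadratic form at a unit eigenvector, to which every vector
of norm at most one contributes at most `1`. -/
theorem det_gramMatrix_le {κ : ℝ} (hκ : 0 < κ) (I : Finset ℕ) (x : ℕ → Fin d → ℝ)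
    (hx : ∀ s ∈ I, x s ⬝ᵥ x s ≤ 1) : (gramMatrix κ I x).det ≤ (κ + I.card) ^ d := by
  have hpd := posDef_gramMatrix hκ I x
  have hH := hpd.isHermitian
  rw [hH.det_eq_prod_eigenvalues]
  have : ∀ i ∈ (Finset.univ : Finset (Fin d)), hH.eigenvalues i ≤ κ + I.card := by
    intro i _
    rw [hH.eigenvalues_eq i]
    set v : Fin d → ℝ := ⇑(hH.eigenvectorBasis i) with hv
    have hv1 : v ⬝ᵥ v = 1 := by
      have h := hH.eigenvectorBasis.orthonormal.1 i
      have h2 : ‖hH.eigenvectorBasis i‖ ^ 2 = 1 := by rw [h, one_pow]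
      rw [EuclideanSpace.norm_sq_eq] at h2
      simpa [dotProduct, sq] using h2
    have h3 : star v = v := star_trivial v
    rw [h3, RCLike.re_to_real, dotProduct_gramMatrix_mulVec, hv1, mul_one, add_comm]
    gcongr
    calc _ ≤ ∑ s ∈ I, (1 : ℝ) := by
          refine Finset.sum_le_sum fun s hs => ?_
          have hcs := Finset.sum_mul_sq_le_sq_mul_sq Finset.univ (x s) v
          have e1 : ∑ i, x s i ^ 2 = x s ⬝ᵥ x s := Finset.sum_congr rfl fun i _ => sq _
          have e2 : ∑ i, v i ^ 2 = v ⬝ᵥ v := Finset.sum_congr rfl fun i _ => sq _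
          rw [e1, e2, hv1, mul_one] at hcs
          rw [← sq]
          exact hcs.trans (hx s hs)
      _ = I.card := by simp
  calc _ ≤ ∏ _i : Fin d, (κ + I.card) :=
        Finset.prod_le_prod (fun i _ => (hpd.eigenvalues_pos i).le) this
    _ = _ := by simp

theorem gramMatrix_empty_det (κ : ℝ) (x : ℕ → Fin d → ℝ) : (gramMatrix κ ∅ x).det = κ ^ d := by
  simp [gramMatrix]

/-- The elliptic potential lemma over `L` consecutive rounds. -/
theorem sum_gramMatrix_inv_le {κ : ℝ} (hκ : 0 < κ) (x : ℕ → Fin d → ℝ) (n L : ℕ)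
    (hx : ∀ s ∈ Finset.Ico n (n + L), x s ⬝ᵥ x s ≤ 1) :
    ∑ t ∈ Finset.Ico n (n + L), x t ⬝ᵥ (gramMatrix κ (Finset.Ico n t) x)⁻¹.mulVec (x t) ≤
      (1 + 1 / κ) * (d * Real.log (1 + L / κ)) := by
  have hstep : ∀ j ≤ L,
      ∑ t ∈ Finset.Ico n (n + j), x t ⬝ᵥ (gramMatrix κ (Finset.Ico n t) x)⁻¹.mulVec (x t) ≤
        (1 + 1 / κ) * (Real.log (gramMatrix κ (Finset.Ico n (n + j)) x).det
          - Real.log (κ ^ d)) := by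
    intro j
    induction j with
    | zero => intro _; simp [gramMatrix_empty_det]
    | succ j ih =>
      intro hj
      specialize ih (by omega)
      have hmem : n + j ∈ Finset.Ico n (n + L) := Finset.mem_Ico.2 ⟨by omega, by omega⟩
      rw [← add_assoc, Finset.sum_Ico_succ_top (by omega),
        ← Finset.insert_Ico_right_eq_Ico_add_one (Nat.le_add_right n j),
        det_gramMatrix_insert hκ (by simp)]
      set u := x (n + j) ⬝ᵥ (gramMatrix κ (Finset.Ico n (n + j)) x)⁻¹.mulVec (x (n + j)) with hu
      have hu0 : 0 ≤ u := dotProduct_gramMatrix_inv_mulVec_nonneg hκ _ x _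
      have hu1 : u ≤ 1 / κ :=
        (dotProduct_gramMatrix_inv_mulVec_le hκ _ x _).trans
          (div_le_div_of_nonneg_right (hx _ hmem) hκ.le)
      rw [Real.log_mul (posDef_gramMatrix hκ _ x).det_pos.ne' (by positivity)]
      have hlog := Real.one_sub_inv_le_log_of_pos (by linarith : 0 < 1 + u)
      have hlog0 : 0 ≤ Real.log (1 + u) := Real.log_nonneg (by linarith)
      -- With `u ≤ 1 / κ` this bounds `u` by a multiple of the log-determinant increment without
      -- assuming `κ ≥ 1`; hence the factor `1 + 1 / κ`.
      have h1 : u ≤ (1 + u) * Real.log (1 + u) := by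
        have h2 := mul_le_mul_of_nonneg_left hlog (by linarith : 0 ≤ 1 + u)
        have h3 : (1 + u) * (1 - (1 + u)⁻¹) = u := by
          field_simp
          ring
        linarith
      have h4 : (1 + u) * Real.log (1 + u) ≤ (1 + 1 / κ) * Real.log (1 + u) :=
        mul_le_mul_of_nonneg_right (by linarith) hlog0
      linarith
  refine (hstep L le_rfl).trans ?_
  refine mul_le_mul_of_nonneg_left ?_ (by positivity)
  have hdet := det_gramMatrix_le hκ (Finset.Ico n (n + L)) x hx
  rw [Nat.card_Ico, Nat.add_sub_cancel_left] at hdet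
  have hlog := Real.log_le_log (posDef_gramMatrix hκ _ x).det_pos hdet
  have hfac : κ + L = κ * (1 + L / κ) := by field_simp
  have hpos : 0 < 1 + L / κ := by positivity
  rw [Real.log_pow, hfac, Real.log_mul hκ.ne' hpos.ne'] at hlog
  rw [Real.log_pow]
  linarith

end

/-! ### Self-concordance -/

/-- `f'' ≥ -f'` makes `f'(x) e^x` nondecreasing, so `f'(z + s) ≥ f'(z) e^{-s}` for `s ≥ 0`.
Integrating, `f(z + w) - f(z) ≥ f'(z) (1 - e^{-w})`, and `1 - e^{-w} ≥ w / (1 + w)`. -/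
theorem mul_le_of_selfConcordant_of_nonneg {f : ℝ → ℝ} (hf : Differentiable ℝ f)
    (hf' : Differentiable ℝ (deriv f)) (h : ∀ x, |deriv (deriv f) x| ≤ deriv f x) (z : ℝ) {w : ℝ}
    (hw : 0 ≤ w) : deriv f z * w ≤ (1 + w) * (f (z + w) - f z) := by
  have hder : ∀ x, HasDerivAt (fun x => deriv f x * Real.exp x)
      (deriv (deriv f) x * Real.exp x + deriv f x * Real.exp x) x := fun x =>
    (hf' x).hasDerivAt.mul (Real.hasDerivAt_exp x)
  have hmono : Monotone fun x => deriv f x * Real.exp x := by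
    refine monotone_of_deriv_nonneg (fun x => (hder x).differentiableAt) fun x => ?_
    rw [(hder x).deriv, ← add_mul]
    exact mul_nonneg (by linarith [(abs_le.1 (h x)).1]) (Real.exp_pos _).le
  have hder2 : ∀ x, HasDerivAt (fun x => f x + deriv f z * Real.exp (z - x))
      (deriv f x + deriv f z * (Real.exp (z - x) * (-1))) x := fun x =>
    (hf x).hasDerivAt.add ((((hasDerivAt_id x).const_sub z).exp).const_mul _)
  have hmono2 : MonotoneOn (fun x => f x + deriv f z * Real.exp (z - x)) (Set.Ici z) := by
    refine monotoneOn_of_deriv_nonneg (convex_Ici z)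
      (fun x _ => (hder2 x).continuousAt.continuousWithinAt)
      (fun x _ => (hder2 x).differentiableAt.differentiableWithinAt) fun x hx => ?_
    rw [interior_Ici] at hx
    rw [(hder2 x).deriv]
    have h1 := hmono (le_of_lt hx)
    simp only at h1
    have h2 := mul_le_mul_of_nonneg_right h1 (Real.exp_pos (-x)).le
    rw [mul_assoc, ← Real.exp_add, mul_assoc, ← Real.exp_add, add_neg_cancel, Real.exp_zero,
      mul_one, ← sub_eq_add_neg] at h2
    linarith
  have h1 := hmono2 (Set.mem_Ici.2 le_rfl) (Set.mem_Ici.2 (by linarith : z ≤ z + w))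
    (by linarith)
  simp only [sub_self, Real.exp_zero, mul_one, sub_add_cancel_left] at h1
  have h0 : 0 ≤ deriv f z := (abs_nonneg _).trans (h z)
  have h2 : (1 + w) * Real.exp (-w) ≤ 1 := by
    rw [Real.exp_neg, mul_inv_le_iff₀ (Real.exp_pos _), one_mul, add_comm]
    exact Real.add_one_le_exp w
  nlinarith [mul_le_mul_of_nonneg_left h2 h0]

theorem mul_sq_le_of_selfConcordant {f : ℝ → ℝ} (hf : Differentiable ℝ f)
    (hf' : Differentiable ℝ (deriv f)) (h : ∀ x, |deriv (deriv f) x| ≤ deriv f x) (z w : ℝ) :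
    deriv f z * w ^ 2 ≤ (1 + |w|) * ((f (z + w) - f z) * w) := by
  rcases le_total 0 w with hw | hw
  · have := mul_le_of_selfConcordant_of_nonneg hf hf' h z hw
    rw [abs_of_nonneg hw]
    nlinarith
  -- The class is stable under `f ↦ -f(-·)`, which reduces negative `w` to positive `w`.
  · have e1 : deriv (fun x => -f (-x)) = fun x => deriv f (-x) := by
      ext x
      simp [deriv_comp_neg]
    have e2 : deriv (deriv (fun x => -f (-x))) = fun x => -deriv (deriv f) (-x) := by
      ext x
      rw [e1, deriv_comp_neg]
    have := mul_le_of_selfConcordant_of_nonneg (f := fun x => -f (-x))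
      ((hf.comp differentiable_neg).neg) (by rw [e1]; exact hf'.comp differentiable_neg)
      (fun x => by rw [e2, e1, abs_neg]; exact h (-x)) (-z) (w := -w) (by linarith)
    rw [e1] at this
    simp only [neg_neg, neg_add_rev] at this
    rw [abs_of_nonpos hw, add_comm z w]
    nlinarith

/-! ### The penalised maximum-likelihood estimate -/

section

variable {d : ℕ}

/-- The score equation tested in the direction `x`, from the vanishing derivative of the objective
along the line `θ + u x`. -/
theorem sum_residual_eq_of_isMaxOn {c b : ℝ → ℝ} (hb : Differentiable ℝ b) {lam τ : ℝ}
    {a : ℕ → Vec d} {r : ℕ → ℝ} {t : ℕ} {θ : Vec d}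
    (hθ : IsMaxOn (penLogLik c b lam τ a r t) Set.univ θ) (x : Vec d) :
    ∑ s ∈ window τ t, (r (s + 1) - meanFn b (inner ℝ (a s) θ)) * inner ℝ (a s) x =
      lam * inner ℝ θ x := by
  have hmax : IsLocalMax (fun u : ℝ => penLogLik c b lam τ a r t (θ + u • x)) 0 := by
    refine Filter.Eventually.of_forall fun u => ?_
    simpa using hθ (Set.mem_univ (θ + u • x))
  have hlin : ∀ s, HasDerivAt (fun u : ℝ => (inner ℝ (a s) (θ + u • x) : ℝ))
      (inner ℝ (a s) x) 0 := by
    intro s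
    simp_rw [inner_add_right, real_inner_smul_right]
    simpa using ((hasDerivAt_id (0 : ℝ)).mul_const (inner ℝ (a s) x : ℝ)).const_add
      (inner ℝ (a s) θ : ℝ)
  have hsq : HasDerivAt (fun u : ℝ => ‖θ + u • x‖ ^ 2) (2 * inner ℝ θ x) 0 := by
    have e : (fun u : ℝ => ‖θ + u • x‖ ^ 2) =
        fun u => ‖θ‖ ^ 2 + (u * (2 * inner ℝ θ x) + u ^ 2 * ‖x‖ ^ 2) := by
      ext u
      rw [norm_add_sq_real, real_inner_smul_right, norm_smul, mul_pow, Real.norm_eq_abs, sq_abs]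
      ring
    rw [e]
    simpa using (((hasDerivAt_id (0 : ℝ)).mul_const (2 * inner ℝ θ x : ℝ)).add
      (((hasDerivAt_id (0 : ℝ)).pow 2).mul_const (‖x‖ ^ 2))).const_add (‖θ‖ ^ 2)
  have hterm : ∀ s, HasDerivAt
      (fun u : ℝ => logDensity c b (inner ℝ (a s) (θ + u • x)) (r (s + 1)))
      ((r (s + 1) - meanFn b (inner ℝ (a s) θ)) * inner ℝ (a s) x) 0 := by
    intro s
    have hb' : HasDerivAt b (meanFn b (inner ℝ (a s) θ)) (inner ℝ (a s) (θ + (0 : ℝ) • x)) := by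
      rw [zero_smul, add_zero]
      exact (hb _).hasDerivAt
    have := (((hlin s).const_mul (r (s + 1))).sub (hb'.comp 0 (hlin s))).add_const (c (r (s + 1)))
    rw [sub_mul]
    exact this
  have hder : HasDerivAt (fun u : ℝ => penLogLik c b lam τ a r t (θ + u • x))
      (∑ s ∈ window τ t, (r (s + 1) - meanFn b (inner ℝ (a s) θ)) * inner ℝ (a s) x
        - lam / 2 * (2 * inner ℝ θ x)) 0 := by
    unfold penLogLik
    exact (HasDerivAt.fun_sum fun s _ => hterm s).sub (hsq.const_mul _)
  have := hmax.hasDerivAt_eq_zero hder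
  linarith

/-- In a round whose window contains no change of the parameter, the estimation error is
controlled in the norm of the Fisher information. -/
theorem fisherForm_error_le {S : ℝ} {k : ℝ≥0} {c b : ℝ → ℝ} (hbd : ContDiff ℝ 2 b)
    (hb : IsRegularMean d S k b) {lam τ ρ : ℝ} (hlam : 0 < lam) (hρ : 0 ≤ ρ)
    {θs a : ℕ → Vec d} {r : ℕ → ℝ} {t : ℕ} {θ θhat : Vec d} (hθS : ‖θ‖ ≤ S)
    (hconst : ∀ s ∈ window τ t, θs s = θ) (ha : ∀ s ∈ window τ t, ‖a s‖ ≤ 1)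
    (hθ : IsMaxOn (penLogLik c b lam τ a r t) Set.univ θhat)
    (hconc : ∀ ξ : Vec d, inner ℝ (noiseVec b τ θs a r t) ξ ≤
      ρ * Real.sqrt (fisherForm b τ θs a t ξ + lam * ‖ξ‖ ^ 2)) :
    fisherForm b τ θs a t (θhat - θ) + lam * ‖θhat - θ‖ ^ 2 ≤
      lam * (1 + S + Real.sqrt ((1 + S) / lam) * ρ + (ρ / Real.sqrt lam) ^ 2) ^ 3 := by
  have hS : 0 ≤ S := (norm_nonneg _).trans hθS
  have hbdiff : Differentiable ℝ b := hbd.differentiable (by norm_num)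
  have hmdiff : Differentiable ℝ (meanFn b) :=
    ((contDiff_succ_iff_deriv (n := 1)).1 hbd).2.2.differentiable (by norm_num)
  set v := θhat - θ with hv
  set μ := meanFn b with hμ
  -- The increment from `θ` to `θhat` of the gradient of the penalised negative log-likelihood,
  -- paired with `v`. It dominates the Fisher form by self-concordance and is computed exactly by
  -- the score equation.
  set qG := ∑ s ∈ window τ t, (μ (inner ℝ (a s) θhat) - μ (inner ℝ (a s) θ)) * inner ℝ (a s) v
    + lam * ‖v‖ ^ 2 with hqG
  have hterm : ∀ s ∈ window τ t, deriv μ (inner ℝ (a s) (θs s)) * inner ℝ (a s) v ^ 2 ≤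
      (1 + ‖v‖) * ((μ (inner ℝ (a s) θhat) - μ (inner ℝ (a s) θ)) * inner ℝ (a s) v) ∧
      0 ≤ (μ (inner ℝ (a s) θhat) - μ (inner ℝ (a s) θ)) * inner ℝ (a s) v := by
    intro s hs
    have h1 := mul_sq_le_of_selfConcordant hmdiff hb.differentiable_deriv hb.selfConcordant
      (inner ℝ (a s) θ) (inner ℝ (a s) v)
    have h2 : (inner ℝ (a s) θ : ℝ) + inner ℝ (a s) v = inner ℝ (a s) θhat := by
      rw [hv, inner_sub_right]; ring
    rw [h2] at h1
    have h3 : 0 ≤ (μ (inner ℝ (a s) θhat) - μ (inner ℝ (a s) θ)) * inner ℝ (a s) v := by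
      have h4 : 0 ≤ deriv (meanFn b) (inner ℝ (a s) θ) * inner ℝ (a s) v ^ 2 :=
        mul_nonneg (hb.deriv_nonneg _) (sq_nonneg _)
      exact nonneg_of_mul_nonneg_right (h4.trans h1) (by positivity)
    refine ⟨?_, h3⟩
    rw [hconst s hs]
    refine h1.trans (mul_le_mul_of_nonneg_right ?_ h3)
    have : |(inner ℝ (a s) v : ℝ)| ≤ ‖a s‖ * ‖v‖ := abs_real_inner_le_norm _ _
    have h5 := mul_le_of_le_one_left (norm_nonneg v) (ha s hs)
    linarith
  have hqGlam : lam * ‖v‖ ^ 2 ≤ qG := by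
    have := Finset.sum_nonneg fun s hs => (hterm s hs).2
    rw [hqG]; linarith
  have hqG0 : 0 ≤ qG := le_trans (by positivity) hqGlam
  set Q := fisherForm b τ θs a t v + lam * ‖v‖ ^ 2 with hQ
  have hQqG : Q ≤ (1 + ‖v‖) * qG := by
    have h1 : fisherForm b τ θs a t v ≤ (1 + ‖v‖) * ∑ s ∈ window τ t,
        (μ (inner ℝ (a s) θhat) - μ (inner ℝ (a s) θ)) * inner ℝ (a s) v := by
      rw [Finset.mul_sum]
      exact Finset.sum_le_sum fun s hs => (hterm s hs).1
    rw [hQ, hqG]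
    nlinarith [mul_nonneg (norm_nonneg v) (mul_nonneg hlam.le (sq_nonneg ‖v‖))]
  have hqGeq : qG = inner ℝ (noiseVec b τ θs a r t) v - lam * inner ℝ θ v := by
    have h1 := sum_residual_eq_of_isMaxOn hbdiff hθ v
    have h2 : inner ℝ (noiseVec b τ θs a r t) v =
        ∑ s ∈ window τ t, (r (s + 1) - μ (inner ℝ (a s) θ)) * inner ℝ (a s) v := by
      rw [noiseVec, sum_inner]
      refine Finset.sum_congr rfl fun s hs => ?_
      rw [real_inner_smul_left, noise, hconst s hs]
    have h3 : lam * inner ℝ θhat v = lam * inner ℝ θ v + lam * ‖v‖ ^ 2 := by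
      rw [← real_inner_self_eq_norm_sq, ← mul_add, ← inner_add_left, hv, add_sub_cancel]
    have h4 : ∑ s ∈ window τ t, (μ (inner ℝ (a s) θhat) - μ (inner ℝ (a s) θ)) * inner ℝ (a s) v =
        ∑ s ∈ window τ t, (r (s + 1) - μ (inner ℝ (a s) θ)) * inner ℝ (a s) v -
        ∑ s ∈ window τ t, (r (s + 1) - μ (inner ℝ (a s) θhat)) * inner ℝ (a s) v := by
      rw [← Finset.sum_sub_distrib]
      exact Finset.sum_congr rfl fun s _ => by ring
    rw [hqG, h2, h4, h1, h3]
    ring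
  set l := Real.sqrt lam with hl
  have hl0 : 0 < l := Real.sqrt_pos.2 hlam
  have hl2 : l ^ 2 = lam := Real.sq_sqrt hlam.le
  set g := Real.sqrt qG with hg
  have hg0 : 0 ≤ g := Real.sqrt_nonneg _
  have hg2 : g ^ 2 = qG := Real.sq_sqrt hqG0
  set X := Real.sqrt (1 + ‖v‖) with hX
  have hX0 : 0 ≤ X := Real.sqrt_nonneg _
  have hX2 : X ^ 2 = 1 + ‖v‖ := Real.sq_sqrt (by positivity)
  have hlv : l * ‖v‖ ≤ g := by
    refine Real.le_sqrt_of_sq_le ?_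
    rw [mul_pow, hl2]
    exact hqGlam
  -- Both the noise term and the bias term of `qG = g²` are bounded by multiples of `g`, so one
  -- factor `g` cancels.
  have hgle : g ≤ ρ * X + l * S := by
    have h1 : Real.sqrt Q ≤ X * g := by
      rw [hX, hg, ← Real.sqrt_mul (by positivity)]
      exact Real.sqrt_le_sqrt hQqG
    have h2 : -(inner ℝ θ v : ℝ) ≤ S * ‖v‖ := by
      have := (abs_le.1 (abs_real_inner_le_norm θ v)).1
      have h3 := mul_le_mul_of_nonneg_right hθS (norm_nonneg v)
      linarith
    have h4 : g ^ 2 ≤ (ρ * X + l * S) * g := by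
      calc g ^ 2 = inner ℝ (noiseVec b τ θs a r t) v + lam * -inner ℝ θ v := by
            rw [hg2, hqGeq]; ring
        _ ≤ ρ * Real.sqrt Q + lam * (S * ‖v‖) := by
            gcongr
            exact hconc v
        _ ≤ ρ * (X * g) + l * S * (l * ‖v‖) := by
            rw [← hl2]
            have := mul_le_mul_of_nonneg_left h1 hρ
            nlinarith
        _ ≤ ρ * (X * g) + l * S * g := by gcongr
        _ = _ := by ring
    rcases hg0.eq_or_lt with h0 | h0
    · rw [← h0]; positivity
    · rw [sq] at h4
      exact le_of_mul_le_mul_right h4 h0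
  set y := ρ / l with hy
  have hy0 : 0 ≤ y := by positivity
  have hρy : ρ = l * y := by rw [hy]; field_simp
  have hgl : g ≤ l * (S + X * y) := by
    rw [hρy] at hgle
    linarith
  have hvle : ‖v‖ ≤ S + X * y := le_of_mul_le_mul_left (hlv.trans hgl) hl0
  set s := Real.sqrt (1 + S) with hs
  have hs0 : 0 ≤ s := Real.sqrt_nonneg _
  have hs2 : s ^ 2 = 1 + S := Real.sq_sqrt (by linarith)
  -- `X² = 1 + ‖v‖ ≤ s² + X y` is a quadratic inequality in `X`. Solving it bounds `‖v‖`, although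
  -- `θhat` is not constrained to the ball of radius `S`.
  have hXle : X ≤ s + y := by
    by_contra! hlt
    have h1 : X ^ 2 ≤ s ^ 2 + X * y := by rw [hX2, hs2]; linarith
    nlinarith
  have hZ : 1 + S + Real.sqrt ((1 + S) / lam) * ρ + y ^ 2 = 1 + S + s * y + y ^ 2 := by
    rw [Real.sqrt_div (by linarith), hy]
    ring
  rw [hZ]
  set Z := 1 + S + s * y + y ^ 2 with hZdef
  have hZ0 : 0 ≤ Z := by positivity
  have hXy : X * y ≤ s * y + y ^ 2 := by nlinarith
  have hgZ : g ≤ l * Z := hgl.trans (mul_le_mul_of_nonneg_left (by linarith) hl0.le)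
  have hvZ : 1 + ‖v‖ ≤ Z := by linarith
  calc Q ≤ (1 + ‖v‖) * qG := hQqG
    _ ≤ Z * (l * Z) ^ 2 := by
        rw [← hg2]
        gcongr
    _ = lam * Z ^ 3 := by rw [← hl2]; ring

theorem cMu_le_deriv {S : ℝ} {k : ℝ≥0} {b : ℝ → ℝ} (hb : IsRegularMean d S k b) {x θ : Vec d}
    (hx : ‖x‖ ≤ 1) (hθ : ‖θ‖ ≤ S) : cMu d S b ≤ deriv (meanFn b) (inner ℝ x θ) := by
  refine csInf_le ⟨0, ?_⟩ ⟨θ, x, hθ, hx, rfl⟩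
  rintro _ ⟨_, _, _, _, rfl⟩
  exact hb.deriv_nonneg _

theorem cMu_le {S : ℝ} {k : ℝ≥0} {b : ℝ → ℝ} (hb : IsRegularMean d S k b) (hS : 0 ≤ S) :
    cMu d S b ≤ k :=
  (cMu_le_deriv hb (x := 0) (θ := 0) (by simp) (by simpa)).trans (hb.deriv_le _)

theorem inner_eq_dotProduct (x y : Vec d) : inner ℝ x y = x.ofLp ⬝ᵥ y.ofLp := by
  rw [EuclideanSpace.inner_eq_star_dotProduct, star_trivial, dotProduct_comm]

theorem rho_nonneg {T : ℕ} {m k lam τ δ : ℝ} (hm : 0 < m) (hk : 0 ≤ k) (hlam : 0 < lam)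
    (hτ : 0 ≤ τ) (hTδ : 1 ≤ T / δ) (t : ℕ) : 0 ≤ rho d T m k lam τ δ t := by
  have h1 : 0 ≤ Real.log (T / δ) := Real.log_nonneg hTδ
  have h2 : 0 ≤ Real.log (1 + k * min (t : ℝ) τ / (d * lam)) := by
    refine Real.log_nonneg ?_
    have : 0 ≤ min (t : ℝ) τ := le_min (Nat.cast_nonneg _) hτ
    have : 0 ≤ k * min (t : ℝ) τ / (d * lam) := by positivity
    linarith
  have h3 : 0 ≤ Real.log 2 := Real.log_nonneg (by norm_num)
  unfold rho
  positivity

/-- The prediction error is at most the exploration bonus. -/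
theorem abs_meanFn_sub_le_bonus {T : ℕ} {S m : ℝ} {k : ℝ≥0} {c b : ℝ → ℝ} (hbd : ContDiff ℝ 2 b)
    (hb : IsRegularMean d S k b) {lam τ δ : ℝ} (hm : 0 < m) (hlam : 0 < lam) (hτ : 0 ≤ τ)
    (hTδ : 1 ≤ T / δ) {θs a : ℕ → Vec d} {r : ℕ → ℝ} {t : ℕ} {θ θhat : Vec d} (hθS : ‖θ‖ ≤ S)
    (hconst : ∀ s ∈ window τ t, θs s = θ) (ha : ∀ s ∈ window τ t, ‖a s‖ ≤ 1)
    (hθ : IsMaxOn (penLogLik c b lam τ a r t) Set.univ θhat)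
    (hconc : ∀ ξ : Vec d, inner ℝ (noiseVec b τ θs a r t) ξ ≤ rho d T m k lam τ δ t *
      Real.sqrt (fisherForm b τ θs a t ξ + lam * ‖ξ‖ ^ 2)) (x : Vec d) :
    |meanFn b (inner ℝ x θhat) - meanFn b (inner ℝ x θ)| ≤
      beta d T S m k lam τ δ t / Real.sqrt (cMu d S b)
        * matNorm (designMatrix lam (cMu d S b) τ a t)⁻¹ x := by
  have hS : 0 ≤ S := (norm_nonneg _).trans hθS
  have hρ := rho_nonneg (d := d) hm k.coe_nonneg hlam hτ hTδ t
  have herr := fisherForm_error_le hbd hb hlam hρ hθS hconst ha hθ hconc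
  have hc := hb.cMu_pos
  set v := θhat - θ with hv
  set Z := 1 + S + Real.sqrt ((1 + S) / lam) * rho d T m k lam τ δ t
    + (rho d T m k lam τ δ t / Real.sqrt lam) ^ 2 with hZ
  have hZ0 : 0 ≤ Z := by positivity
  rw [designMatrix_eq_gramMatrix]
  set cm := cMu d S b with hcm
  set G := gramMatrix (lam / cm) (window τ t) (fun s => (a s).ofLp) with hG
  -- On the window the Fisher weights are derivatives at the true parameter, hence at least `c_μ`;
  -- the regulariser `lam / c_μ` of the design matrix becomes exactly `lam`.
  have hVv : cm * (v.ofLp ⬝ᵥ G.mulVec v.ofLp) ≤ lam * Z ^ 3 := by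
    refine le_trans ?_ herr
    rw [hG, dotProduct_gramMatrix_mulVec, mul_add, Finset.mul_sum, fisherForm]
    refine add_le_add (Finset.sum_le_sum fun s hs => ?_) (le_of_eq ?_)
    · rw [← inner_eq_dotProduct, ← sq]
      refine mul_le_mul_of_nonneg_right ?_ (sq_nonneg _)
      rw [hconst s hs]
      exact cMu_le_deriv hb (ha s hs) hθS
    · rw [← inner_eq_dotProduct, real_inner_self_eq_norm_sq]
      field_simp
  have hcs := sq_dotProduct_le_gramMatrix (div_pos hlam hc) (window τ t) (fun s => (a s).ofLp)
    x.ofLp v.ofLp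
  rw [← hG, ← inner_eq_dotProduct] at hcs
  set N := x.ofLp ⬝ᵥ G⁻¹.mulVec x.ofLp with hN
  have hN0 : 0 ≤ N := dotProduct_gramMatrix_inv_mulVec_nonneg (div_pos hlam hc) _ _ _
  have h1 : |(inner ℝ x v : ℝ)| ≤ Real.sqrt lam * Z ^ (3 / 2 : ℝ) / Real.sqrt cm * Real.sqrt N := by
    refine abs_le_of_sq_le_sq ?_ (by positivity)
    have hZ3 : (Z ^ (3 / 2 : ℝ)) ^ 2 = Z ^ 3 := by
      rw [← Real.rpow_natCast, ← Real.rpow_mul hZ0, ← Real.rpow_natCast]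
      norm_num
    rw [mul_pow, div_pow, mul_pow, Real.sq_sqrt hlam.le, Real.sq_sqrt hc.le, Real.sq_sqrt hN0, hZ3]
    refine hcs.trans ?_
    rw [mul_comm]
    refine mul_le_mul_of_nonneg_right ?_ hN0
    rwa [le_div_iff₀' hc]
  have h2 := hb.lipschitz.dist_le_mul (inner ℝ x θhat) (inner ℝ x θ)
  rw [Real.dist_eq, Real.dist_eq, ← inner_sub_right] at h2
  refine h2.trans ((mul_le_mul_of_nonneg_left h1 k.coe_nonneg).trans (le_of_eq ?_))
  rw [beta, matNorm, ← hZ, ← hN]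
  ring

end

/-! ### Regret of a single round -/

section

variable {d : ℕ}

theorem meanFn_sub_le {S : ℝ} {k : ℝ≥0} {b : ℝ → ℝ} (hb : LipschitzWith k (meanFn b))
    {x y θ : Vec d} (hx : ‖x‖ ≤ 1) (hy : ‖y‖ ≤ 1) (hθ : ‖θ‖ ≤ S) :
    meanFn b (inner ℝ x θ) - meanFn b (inner ℝ y θ) ≤ 2 * k * S := by
  have h1 := hb.dist_le_mul (inner ℝ x θ) (inner ℝ y θ)
  rw [Real.dist_eq, Real.dist_eq, ← inner_sub_left] at h1
  have h2 : |(inner ℝ (x - y) θ : ℝ)| ≤ 2 * S := by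
    have h3 : ‖x - y‖ ≤ 2 := (norm_sub_le x y).trans (by linarith)
    exact (abs_real_inner_le_norm _ _).trans (mul_le_mul h3 hθ (norm_nonneg _) zero_le_two)
  calc _ ≤ _ := le_abs_self _
    _ ≤ _ := h1
    _ ≤ k * (2 * S) := mul_le_mul_of_nonneg_left h2 k.coe_nonneg
    _ = _ := by ring

theorem bestMean_sub_nonneg {S : ℝ} {k : ℝ≥0} {b : ℝ → ℝ} (hb : LipschitzWith k (meanFn b))
    {A : Set (Vec d)} {y θ : Vec d} (hA : ∀ x ∈ A, ‖x‖ ≤ 1) (hy : y ∈ A) (hθ : ‖θ‖ ≤ S) :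
    0 ≤ bestMean b θ A - meanFn b (inner ℝ y θ) := by
  rw [sub_nonneg]
  -- The Lipschitz bound shows that the set of mean rewards is bounded above; without boundedness
  -- `sSup` would take the default value `0`.
  refine le_csSup ⟨meanFn b (inner ℝ y θ) + 2 * k * S, ?_⟩ ⟨y, hy, rfl⟩
  rintro _ ⟨x, hx, rfl⟩
  have := meanFn_sub_le hb (hA x hx) (hA y hy) hθ
  simp only
  linarith

theorem bestMean_sub_le {b : ℝ → ℝ} {A : Set (Vec d)} {y θ : Vec d} {B : ℝ} (hy : y ∈ A)
    (hB : ∀ x ∈ A, meanFn b (inner ℝ x θ) - meanFn b (inner ℝ y θ) ≤ B) :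
    bestMean b θ A - meanFn b (inner ℝ y θ) ≤ B := by
  rw [sub_le_iff_le_add]
  refine csSup_le ⟨_, y, hy, rfl⟩ ?_
  rintro _ ⟨x, hx, rfl⟩
  have := hB x hx
  simp only
  linarith

/-- Optimism: when the bonus dominates the prediction error, the regret of a round is at most
twice the bonus of the action played. -/
theorem bestMean_sub_le_two_mul_bonus {T : ℕ} {S m k lam τ δ : ℝ} {b : ℝ → ℝ} {a : ℕ → Vec d}
    {t : ℕ} {θ θhat : Vec d} {A : Set (Vec d)} (hat : a t ∈ A)
    (hmax : IsMaxOn (ucb T S m k lam τ δ b a t θhat) A (a t))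
    (hbonus : ∀ x : Vec d, |meanFn b (inner ℝ x θhat) - meanFn b (inner ℝ x θ)| ≤
      beta d T S m k lam τ δ t / Real.sqrt (cMu d S b)
        * matNorm (designMatrix lam (cMu d S b) τ a t)⁻¹ x) :
    bestMean b θ A - meanFn b (inner ℝ (a t) θ) ≤
      2 * (beta d T S m k lam τ δ t / Real.sqrt (cMu d S b)
        * matNorm (designMatrix lam (cMu d S b) τ a t)⁻¹ (a t)) := by
  refine bestMean_sub_le hat fun x hx => ?_
  have h1 : ucb T S m k lam τ δ b a t θhat x ≤ ucb T S m k lam τ δ b a t θhat (a t) := hmax hx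
  unfold ucb at h1
  have h2 := (abs_le.1 (hbonus x)).1
  have h3 := (abs_le.1 (hbonus (a t))).2
  linarith

/-! ### Rounds whose window contains a change -/

theorem exists_change_of_ne {θs : ℕ → Vec d} {s t : ℕ} (hst : s ≤ t) (h : θs s ≠ θs t) :
    ∃ u, s < u ∧ u ≤ t ∧ θs u ≠ θs (u - 1) := by
  induction t, hst using Nat.le_induction with
  | base => exact absurd rfl h
  | succ t hst ih =>
    by_cases heq : θs s = θs t
    · exact ⟨t + 1, by omega, le_rfl, by rw [Nat.add_sub_cancel, ← heq]; exact h.symm⟩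
    · obtain ⟨u, h1, h2, h3⟩ := ih heq
      exact ⟨u, h1, by omega, h3⟩

open Classical in
/-- The rounds whose window contains a parameter different from the current one. -/
def staleRounds (T : ℕ) (τ : ℝ) (θs : ℕ → Vec d) : Finset ℕ :=
  (Finset.Icc 1 T).filter fun t => ∃ s ∈ window τ t, θs s ≠ θs t

open Classical in
-- If `s` in the window of `t` has another parameter, some change `u` satisfies `s < u ≤ t`, and `t
-- - τ ≤ s` gives `t < u + τ`. So each change spoils at most `⌈τ⌉` rounds.
theorem card_staleRounds_le (T : ℕ) {τ : ℝ} (hτ : 0 ≤ τ) (θs : ℕ → Vec d) :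
    ((staleRounds T τ θs).card : ℝ) ≤ numChanges T θs * (τ + 1) := by
  set Ch : Finset ℕ := (Finset.Icc 2 T).filter fun u => θs u ≠ θs (u - 1) with hCh
  have hnum : numChanges T θs = Ch.card := by
    rw [numChanges, ← Set.ncard_coe_finset]
    congr 1
    ext u
    simp [hCh, and_assoc]
  have hsub : staleRounds T τ θs ⊆ Ch.biUnion fun u => Finset.Ico u (u + ⌈τ⌉₊) := by
    intro t ht
    obtain ⟨ht1, s, hs, hne⟩ := Finset.mem_filter.1 ht
    obtain ⟨hs1, hs2⟩ := Finset.mem_filter.1 hs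
    rw [Finset.mem_Ico] at hs1
    rw [Finset.mem_Icc] at ht1
    obtain ⟨u, hu1, hu2, hu3⟩ := exists_change_of_ne hs1.2.le hne
    refine Finset.mem_biUnion.2 ⟨u, Finset.mem_filter.2
      ⟨Finset.mem_Icc.2 ⟨by omega, by omega⟩, hu3⟩, Finset.mem_Ico.2 ⟨hu2, ?_⟩⟩
    have h1 : (t : ℝ) < u + ⌈τ⌉₊ := by
      have h2 := Nat.le_ceil τ
      have h3 : (s : ℝ) < u := by exact_mod_cast hu1
      linarith
    exact_mod_cast h1
  have h1 : (staleRounds T τ θs).card ≤ Ch.card * ⌈τ⌉₊ := by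
    refine (Finset.card_le_card hsub).trans (Finset.card_biUnion_le_card_mul _ _ _ fun u _ => ?_)
    rw [Nat.card_Ico, Nat.add_sub_cancel_left]
  calc ((staleRounds T τ θs).card : ℝ) ≤ Ch.card * ⌈τ⌉₊ := by exact_mod_cast h1
    _ ≤ Ch.card * (τ + 1) :=
        mul_le_mul_of_nonneg_left (Nat.ceil_lt_add_one hτ).le (Nat.cast_nonneg _)
    _ = _ := by rw [hnum]

/-! ### The elliptic potential over sliding windows -/

/-- Time is cut into blocks of length `L ≤ τ`. Inside a block the window contains every earlier
round of the block, so by antitonicity the sliding-window potential is at most that of a Gram matrix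
restarted at each block. -/
theorem sum_window_gramMatrix_inv_le {κ τ : ℝ} (hκ : 0 < κ) (x : ℕ → Fin d → ℝ)
    (hx : ∀ s, x s ⬝ᵥ x s ≤ 1) {L : ℕ} (hL : (L : ℝ) ≤ τ) (n : ℕ) :
    ∑ t ∈ Finset.Ico 1 (1 + n * L), x t ⬝ᵥ (gramMatrix κ (window τ t) x)⁻¹.mulVec (x t) ≤
      n * ((1 + 1 / κ) * (d * Real.log (1 + L / κ))) := by
  induction n with
  | zero => simp
  | succ n ih =>
    have hsplit : 1 + (n + 1) * L = (1 + n * L) + L := by ring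
    rw [hsplit, ← Finset.sum_Ico_consecutive _ (by omega : 1 ≤ 1 + n * L) (Nat.le_add_right _ L)]
    have h1 : ∑ t ∈ Finset.Ico (1 + n * L) (1 + n * L + L),
        x t ⬝ᵥ (gramMatrix κ (window τ t) x)⁻¹.mulVec (x t) ≤
        (1 + 1 / κ) * (d * Real.log (1 + L / κ)) := by
      refine le_trans (Finset.sum_le_sum fun t ht => ?_)
        (sum_gramMatrix_inv_le hκ x (1 + n * L) L fun s _ => hx s)
      refine gramMatrix_inv_antitone hκ (fun s hs => ?_) x (x t)
      rw [Finset.mem_Ico] at ht hs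
      refine Finset.mem_filter.2 ⟨Finset.mem_Ico.2 ⟨by omega, hs.2⟩, ?_⟩
      have h2 : (t : ℝ) ≤ s + L := by exact_mod_cast (by omega : t ≤ s + L)
      linarith
    push_cast
    linarith

theorem sum_sq_matNorm_le {lam cm τ : ℝ} (hlam : 0 < lam) (hcm : 0 < cm) {T : ℕ} (hτ1 : 1 ≤ τ)
    (hτT : τ ≤ T) (a : ℕ → Vec d) (ha : ∀ s ∈ Finset.Icc 1 T, ‖a s‖ ≤ 1) :
    ∑ t ∈ Finset.Icc 1 T, matNorm (designMatrix lam cm τ a t)⁻¹ (a t) ^ 2 ≤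
      3 * T / τ * ((1 + cm / lam) * (d * Real.log (1 + T * (cm / lam)))) := by
  have hκ : 0 < lam / cm := div_pos hlam hcm
  set κ := lam / cm with hκdef
  have hκi : 1 / κ = cm / lam := by rw [hκdef, one_div_div]
  -- The last block may run past `T`, where actions are not controlled; they are replaced by `0`.
  set x : ℕ → Fin d → ℝ := fun s => if s ∈ Finset.Icc 1 T then (a s).ofLp else 0 with hxdef
  have hx : ∀ s, x s ⬝ᵥ x s ≤ 1 := by
    intro s
    by_cases hs : s ∈ Finset.Icc 1 T
    · simp only [hxdef, if_pos hs]
      rw [← inner_eq_dotProduct, real_inner_self_eq_norm_sq]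
      exact pow_le_one₀ (norm_nonneg _) (ha s hs)
    · simp only [hxdef, if_neg hs]
      simp
  set L := ⌊τ⌋₊ with hL
  have hLτ : (L : ℝ) ≤ τ := Nat.floor_le (by linarith)
  have hL1 : 1 ≤ L := Nat.one_le_floor_iff _ |>.2 hτ1
  have hL1' : (1 : ℝ) ≤ L := by exact_mod_cast hL1
  have hL2 : τ ≤ 2 * L := by
    have := Nat.lt_floor_add_one τ
    linarith
  set n := T / L + 1 with hn
  have hnL : T ≤ n * L := by
    have := Nat.lt_div_mul_add (a := T) (b := L) (by omega)
    rw [hn, add_mul, one_mul]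
    omega
  -- `τ ≥ 1` gives `τ ≤ 2 ⌊τ⌋`, so at most `2 T / τ` full blocks; the extra block costs `1 ≤ T / τ`.
  have hnle : (n : ℝ) ≤ 3 * T / τ := by
    have h1 : ((T / L : ℕ) : ℝ) ≤ T / L := Nat.cast_div_le
    have h2 : (T : ℝ) / L ≤ 2 * T / τ := by
      rw [div_le_div_iff₀ (by linarith) (by linarith)]
      nlinarith [(Nat.cast_nonneg T : (0 : ℝ) ≤ T)]
    have h3 : 1 ≤ T / τ := by rwa [le_div_iff₀ (by linarith), one_mul]
    rw [hn]
    push_cast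
    calc _ ≤ 2 * T / τ + T / τ := by linarith
      _ = _ := by ring
  have hterm : ∀ t ∈ Finset.Icc 1 T, matNorm (designMatrix lam cm τ a t)⁻¹ (a t) ^ 2 =
      x t ⬝ᵥ (gramMatrix κ (window τ t) x)⁻¹.mulVec (x t) := by
    intro t ht
    have hxt : (a t).ofLp = x t := by simp only [hxdef, if_pos ht]
    have hG : designMatrix lam cm τ a t = gramMatrix κ (window τ t) x := by
      rw [designMatrix_eq_gramMatrix, gramMatrix, gramMatrix]
      congr 1
      refine Finset.sum_congr rfl fun s hs => ?_
      have hs' := window_subset_Icc (T := T) (by have := (Finset.mem_Icc.1 ht).2; omega) hs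
      simp only [hxdef, if_pos hs']
    rw [hG, matNorm, hxt, Real.sq_sqrt (dotProduct_gramMatrix_inv_mulVec_nonneg hκ _ _ _)]
  rw [Finset.sum_congr rfl hterm]
  have hsub : Finset.Icc 1 T ⊆ Finset.Ico 1 (1 + n * L) := by
    intro t ht
    rw [Finset.mem_Icc] at ht
    exact Finset.mem_Ico.2 ⟨ht.1, by omega⟩
  have hTκ : (L : ℝ) / κ ≤ T * (cm / lam) := by
    rw [div_eq_mul_one_div, hκi]
    gcongr
    exact_mod_cast hLτ.trans hτT
  have hlog : Real.log (1 + L / κ) ≤ Real.log (1 + T * (cm / lam)) :=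
    Real.log_le_log (by positivity) (by linarith)
  have hlog0 : 0 ≤ Real.log (1 + L / κ) := Real.log_nonneg (by
    have : 0 ≤ (L : ℝ) / κ := by positivity
    linarith)
  calc _ ≤ _ := Finset.sum_le_sum_of_subset_of_nonneg hsub fun t _ _ =>
        dotProduct_gramMatrix_inv_mulVec_nonneg hκ _ _ _
    _ ≤ _ := sum_window_gramMatrix_inv_le hκ x hx hLτ n
    _ ≤ _ := by
        rw [hκi]
        gcongr

/-! ### Size of the exploration coefficient -/

theorem beta_sq_eq {T : ℕ} {S m k lam τ δ : ℝ} {t : ℕ} (hS : 0 ≤ S) (hlam : 0 < lam)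
    (hρ : 0 ≤ rho d T m k lam τ δ t) :
    beta d T S m k lam τ δ t ^ 2 = k ^ 2 * lam *
      (1 + S + Real.sqrt ((1 + S) / lam) * rho d T m k lam τ δ t
        + (rho d T m k lam τ δ t / Real.sqrt lam) ^ 2) ^ 3 := by
  rw [beta]
  set Z := 1 + S + Real.sqrt ((1 + S) / lam) * rho d T m k lam τ δ t
    + (rho d T m k lam τ δ t / Real.sqrt lam) ^ 2
  have hZ0 : 0 ≤ Z := by positivity
  have hZ3 : (Z ^ (3 / 2 : ℝ)) ^ 2 = Z ^ 3 := by
    rw [← Real.rpow_natCast, ← Real.rpow_mul hZ0, ← Real.rpow_natCast]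
    norm_num
  rw [mul_pow, mul_pow, Real.sq_sqrt hlam.le, hZ3]

theorem log_one_add_two_mul_le {k T : ℝ} (hk : 0 ≤ k) (hT : 1 ≤ T) :
    Real.log (1 + 2 * k * T) ≤ 2 * k + Real.log T := by
  have h1 : Real.log (1 + 2 * k * T) ≤ Real.log ((1 + 2 * k) * T) :=
    Real.log_le_log (by positivity) (by nlinarith)
  rw [Real.log_mul (by positivity) (by positivity)] at h1
  have h2 := Real.log_le_sub_one_of_pos (by positivity : 0 < 1 + 2 * k)
  linarith

theorem half_le_log_of_two_le {x : ℝ} (hx : 2 ≤ x) : 1 / 2 ≤ Real.log x := by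
  have h1 := Real.log_two_gt_d9
  have h2 := Real.log_le_log (by norm_num) hx
  linarith

/-- This explains `lam = d log T`: in `ρ / √lam` the term proportional to `d` is divided by `d log
T`, leaving a bound free of `d`. Constants are absorbed through `log (T / δ) ≥ 1 / 2`. -/
theorem rho_div_sqrt_le {T : ℕ} {m k τ δ : ℝ} {t : ℕ} (hd : 1 ≤ d) (hT : 2 ≤ T) (hm : 0 < m)
    (hk : 0 ≤ k) (hτ : 0 ≤ τ) (hδ : 0 < δ) (hδ1 : δ ≤ 1) (ht : t ≤ T) :
    rho d T m k (d * Real.log T) τ δ t / Real.sqrt (d * Real.log T) ≤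
      (2 * (1 / (2 * m) + 4 * m * k + 3 * m) + 4 * m) * Real.log (T / δ) := by
  have hd1 : (1 : ℝ) ≤ d := by exact_mod_cast hd
  have hT2 : (2 : ℝ) ≤ T := by exact_mod_cast hT
  have ht0 := half_le_log_of_two_le hT2
  set l := Real.log T with hl
  have hlℓ : l ≤ Real.log (T / δ) := by
    refine Real.log_le_log (by linarith) ?_
    rw [le_div_iff₀ hδ]
    nlinarith
  set ℓ := Real.log (T / δ) with hℓ
  have hlam : 0 < d * l := by positivity
  have hlam2 : 1 / 2 ≤ d * l := by nlinarith
  set lam := d * l with hlamdef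
  have hlog : Real.log (1 + k * min (t : ℝ) τ / (d * lam)) ≤ 2 * k + l := by
    refine le_trans (Real.log_le_log ?_ ?_) (log_one_add_two_mul_le hk (by linarith : (1 : ℝ) ≤ T))
    · have : 0 ≤ min (t : ℝ) τ := le_min (Nat.cast_nonneg _) hτ
      positivity
    · have h1 : min (t : ℝ) τ ≤ T := (min_le_left _ _).trans (by exact_mod_cast ht)
      have h2 : 1 / 2 ≤ d * lam := by nlinarith
      have h3 : k * min (t : ℝ) τ / (d * lam) ≤ 2 * k * T := by
        rw [div_le_iff₀ (by linarith)]
        have : k * min (t : ℝ) τ ≤ k * T := mul_le_mul_of_nonneg_left h1 hk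
        nlinarith [mul_nonneg hk (by linarith : (0 : ℝ) ≤ T)]
      linarith
  have hl2 : Real.log 2 ≤ l := Real.log_le_log (by norm_num) hT2
  have hexp : rho d T m k lam τ δ t / Real.sqrt lam = 1 / (2 * m) + 2 * m * ℓ / lam
      + m * Real.log (1 + k * min (t : ℝ) τ / (d * lam)) / l + 2 * m * Real.log 2 / l := by
    rw [rho, ← hℓ]
    have hs : 0 < Real.sqrt lam := Real.sqrt_pos.2 hlam
    have hs2 : Real.sqrt lam * Real.sqrt lam = lam := Real.mul_self_sqrt hlam.le
    have e1 : l = lam / d := by rw [hlamdef]; field_simp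
    generalize Real.log (1 + k * min (t : ℝ) τ / (d * lam)) = l1
    generalize Real.sqrt lam = sl at hs hs2
    rw [e1, ← hs2]
    field_simp
  rw [hexp]
  have b1 : 2 * m * ℓ / lam ≤ 4 * m * ℓ := by
    rw [div_le_iff₀ hlam]
    nlinarith [mul_nonneg hm.le (by linarith : 0 ≤ ℓ)]
  have b2 : m * Real.log (1 + k * min (t : ℝ) τ / (d * lam)) / l ≤ m * (4 * k + 1) := by
    rw [div_le_iff₀ (by linarith), mul_assoc]
    refine mul_le_mul_of_nonneg_left (hlog.trans ?_) hm.le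
    nlinarith
  have b3 : 2 * m * Real.log 2 / l ≤ 2 * m := by
    rw [div_le_iff₀ (by linarith)]
    nlinarith
  have b4 : 1 / (2 * m) + 4 * m * k + 3 * m ≤
      2 * (1 / (2 * m) + 4 * m * k + 3 * m) * ℓ := by
    have : 0 ≤ 1 / (2 * m) + 4 * m * k + 3 * m := by positivity
    nlinarith
  linarith

theorem beta_sq_le {T : ℕ} {S m k τ δ : ℝ} {t : ℕ} (hd : 1 ≤ d) (hT : 2 ≤ T) (hS : 0 ≤ S)
    (hm : 0 < m) (hk : 0 ≤ k) (hτ : 0 ≤ τ) (hδ : 0 < δ) (hδ1 : δ ≤ 1) (ht : t ≤ T) :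
    beta d T S m k (d * Real.log T) τ δ t ^ 2 ≤ k ^ 2 * (d * Real.log T) *
      ((8 * (1 + S) + 2 * (2 * (1 / (2 * m) + 4 * m * k + 3 * m) + 4 * m) ^ 2)
        * Real.log (T / δ) ^ 2) ^ 3 := by
  have hd1 : (1 : ℝ) ≤ d := by exact_mod_cast hd
  have hT2 : (2 : ℝ) ≤ T := by exact_mod_cast hT
  have ht0 := half_le_log_of_two_le hT2
  have hTδ : (2 : ℝ) ≤ T / δ := by
    rw [le_div_iff₀ hδ]
    nlinarith
  have hℓ := half_le_log_of_two_le hTδ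
  have hlam : 0 < d * Real.log T := by positivity
  have hρ := rho_nonneg (d := d) (T := T) (δ := δ) hm hk hlam hτ (by linarith) t
  rw [beta_sq_eq hS hlam hρ]
  have hy := rho_div_sqrt_le hd hT hm hk hτ hδ hδ1 ht
  rw [Real.sqrt_div (by linarith : 0 ≤ 1 + S), div_mul_eq_mul_div, mul_div_assoc]
  set y := rho d T m k (d * Real.log T) τ δ t / Real.sqrt (d * Real.log T) with hydef
  have hy0 : 0 ≤ y := by positivity
  set Y := 2 * (1 / (2 * m) + 4 * m * k + 3 * m) + 4 * m
  set ℓ := Real.log (T / δ)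
  set s := Real.sqrt (1 + S)
  have hs0 : 0 ≤ s := Real.sqrt_nonneg _
  have hs2 : s ^ 2 = 1 + S := Real.sq_sqrt (by linarith)
  have hy2 : y ^ 2 ≤ Y ^ 2 * ℓ ^ 2 := by
    rw [← mul_pow]
    exact pow_le_pow_left₀ hy0 hy 2
  gcongr
  have h1 : 1 ≤ 4 * ℓ ^ 2 := by nlinarith
  nlinarith [sq_nonneg (s - y)]

end

/-! ### The regret bound -/

/-- A bound on `1 + S + √(1 + S) ρ_t / √lam + ρ_t² / lam`, up to a squared logarithm. -/
def expansionConst (S m k : ℝ) : ℝ :=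
  8 * (1 + S) + 2 * (2 * (1 / (2 * m) + 4 * m * k + 3 * m) + 4 * m) ^ 2

/-- The constant of the regret bound. -/
def regretConst (S m k : ℝ) : ℝ :=
  12 * k ^ 2 * expansionConst S m k ^ 3 * (1 + 2 * k) * (4 * k + 1)
    + 256 * (8 * k ^ 2 * S ^ 2 * (1 + k)) + 1

theorem regretConst_pos {S m k : ℝ} (hS : 0 ≤ S) (hm : 0 < m) (hk : 0 ≤ k) :
    0 < regretConst S m k := by
  unfold regretConst expansionConst
  positivity

section

variable {d : ℕ}

/-- The regret in terms of the number of stale rounds and of the elliptic potential. -/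
theorem regret_le_stale_add_potential {T : ℕ} {S m : ℝ} {k : ℝ≥0} {lam τ δ Δ B : ℝ} {c b : ℝ → ℝ}
    {θs a : ℕ → Vec d} {A : ℕ → Set (Vec d)} {r : ℕ → ℝ} (hΔ : 0 < Δ) (hbd : ContDiff ℝ 2 b)
    (hb : IsRegularMean d S k b) (hm : 0 < m) (hlam : 0 < lam) (hτ : 0 ≤ τ) (hTδ : 1 ≤ T / δ)
    (hθS : ∀ t ∈ Finset.Icc 1 T, ‖θs t‖ ≤ S) (hA : ∀ t ∈ Finset.Icc 1 T, ∀ x ∈ A t, ‖x‖ ≤ 1)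
    (hgap : HasMinGap T b θs A Δ) (halg : IsSWGLUCB T S m k lam τ δ c b A a r)
    (hconc : ∀ t ∈ Finset.Icc 1 T, ∀ ξ : Vec d, inner ℝ (noiseVec b τ θs a r t) ξ ≤
      rho d T m k lam τ δ t * Real.sqrt (fisherForm b τ θs a t ξ + lam * ‖ξ‖ ^ 2))
    (hB : ∀ t ∈ Finset.Icc 1 T, beta d T S m k lam τ δ t ^ 2 ≤ B) :
    regret T b θs A a ≤ (staleRounds T τ θs).card * (2 * k * S) +
      Δ⁻¹ * (4 * B / cMu d S b) * ∑ t ∈ Finset.Icc 1 T,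
        matNorm (designMatrix lam (cMu d S b) τ a t)⁻¹ (a t) ^ 2 := by
  classical
  have hc := hb.cMu_pos
  have hat : ∀ t ∈ Finset.Icc 1 T, a t ∈ A t := fun t ht => (halg t ht).choose_spec.2.1
  have hterm : ∀ t ∈ Finset.Icc 1 T, bestMean b (θs t) (A t) - meanFn b (inner ℝ (a t) (θs t)) ≤
      (if t ∈ staleRounds T τ θs then 2 * k * S else 0) +
        Δ⁻¹ * (4 * B / cMu d S b) * matNorm (designMatrix lam (cMu d S b) τ a t)⁻¹ (a t) ^ 2 := by
    intro t ht
    have hreg0 := bestMean_sub_nonneg hb.lipschitz (hA t ht) (hat t ht) (hθS t ht)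
    have hB0 : 0 ≤ B := (sq_nonneg _).trans (hB t ht)
    by_cases hst : t ∈ staleRounds T τ θs
    · rw [if_pos hst]
      have h1 := bestMean_sub_le (b := b) (hat t ht) fun x hx =>
        meanFn_sub_le hb.lipschitz (hA t ht x hx) (hA t ht _ (hat t ht)) (hθS t ht)
      have h2 : 0 ≤ Δ⁻¹ * (4 * B / cMu d S b) *
          matNorm (designMatrix lam (cMu d S b) τ a t)⁻¹ (a t) ^ 2 := by positivity
      linarith
    · rw [if_neg hst, zero_add]
      obtain ⟨θhat, hθ, -, hmax⟩ := halg t ht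
      have hwin : window τ t ⊆ Finset.Icc 1 T :=
        window_subset_Icc (by have := (Finset.mem_Icc.1 ht).2; omega)
      have hconst : ∀ s ∈ window τ t, θs s = θs t := by
        intro s hs
        by_contra hne
        exact hst (Finset.mem_filter.2 ⟨ht, s, hs, hne⟩)
      have hbonus := abs_meanFn_sub_le_bonus (T := T) (δ := δ) hbd hb hm hlam hτ hTδ (hθS t ht)
        hconst (fun s hs => hA s (hwin hs) _ (hat s (hwin hs))) hθ (hconc t ht)
      have hreg := bestMean_sub_le_two_mul_bonus (hat t ht) hmax hbonus
      set R := bestMean b (θs t) (A t) - meanFn b (inner ℝ (a t) (θs t)) with hR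
      set N := matNorm (designMatrix lam (cMu d S b) τ a t)⁻¹ (a t)
      have hsq : R ^ 2 ≤ 4 * B / cMu d S b * N ^ 2 := by
        calc R ^ 2 ≤ (2 * (beta d T S m k lam τ δ t / Real.sqrt (cMu d S b) * N)) ^ 2 :=
              pow_le_pow_left₀ hreg0 hreg 2
          _ = 4 * beta d T S m k lam τ δ t ^ 2 / cMu d S b * N ^ 2 := by
              rw [mul_pow, mul_pow, div_pow, Real.sq_sqrt hc.le]
              ring
          _ ≤ _ := by
              gcongr
              exact hB t ht
      -- A nonzero regret is at least `Δ`; the sum of bonuses is thereby replaced by a sum of their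
      -- squares, to which the elliptic potential applies directly.
      have hΔR : R ≤ Δ⁻¹ * R ^ 2 := by
        rcases hreg0.eq_or_lt with h0 | h0
        · rw [← h0]; simp
        · have h1 : Δ ≤ R := hgap t ht _ (hat t ht) (sub_pos.1 h0)
          rw [le_inv_mul_iff₀ hΔ, sq]
          exact mul_le_mul_of_nonneg_right h1 hreg0
      rw [mul_assoc]
      exact hΔR.trans (mul_le_mul_of_nonneg_left hsq (inv_nonneg.2 hΔ.le))
  refine (Finset.sum_le_sum hterm).trans (le_of_eq ?_)
  rw [Finset.sum_add_distrib, ← Finset.mul_sum, Finset.sum_ite_mem, Finset.sum_const,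
    nsmul_eq_mul, staleRounds,
    Finset.inter_eq_right.2 (Finset.filter_subset _ _)]

/-- Here `3 cm W / d²` stands for `3 T / τ`. The factor `d²` cancels against one `d` from `lam` and
one from the potential; the power `8` of the logarithm is `6` from the cubed expansion, `1` from
`lam` and `1` from the log-determinant. -/
theorem mul_potential_le {d T k cm C ℓ W D : ℝ} (hd : 1 ≤ d) (hT : 2 ≤ T) (hk : 0 ≤ k)
    (hcm : 0 < cm) (hck : cm ≤ k) (hC : 0 ≤ C) (hℓ : Real.log T ≤ ℓ) (hW : 0 ≤ W) (hD : 0 ≤ D) :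
    D * (4 * (k ^ 2 * (d * Real.log T) * (C * ℓ ^ 2) ^ 3) / cm) * (3 * cm * W / d ^ 2 *
        ((1 + cm / (d * Real.log T)) * (d * Real.log (1 + T * (cm / (d * Real.log T)))))) ≤
      12 * k ^ 2 * C ^ 3 * (1 + 2 * k) * (4 * k + 1) * ℓ ^ 8 * (D * W) := by
  have hl := half_le_log_of_two_le hT
  have h3 := log_one_add_two_mul_le hk (by linarith : 1 ≤ T)
  set l := Real.log T
  have hl0 : 0 < l := by linarith
  have hℓ0 : 0 ≤ ℓ := by linarith
  have hdl : 1 / 2 ≤ d * l := by nlinarith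
  have hlog : Real.log (1 + T * (cm / (d * l))) ≤ (4 * k + 1) * ℓ := by
    have h1 : cm / (d * l) ≤ 2 * k := by
      rw [div_le_iff₀ (by linarith)]
      nlinarith
    have h2 : Real.log (1 + T * (cm / (d * l))) ≤ Real.log (1 + 2 * k * T) := by
      refine Real.log_le_log (by positivity) ?_
      nlinarith
    nlinarith
  have hlamc : d * l + cm ≤ (1 + 2 * k) * (d * ℓ) := by
    have h1 : d * l ≤ d * ℓ := mul_le_mul_of_nonneg_left hℓ (by linarith)
    nlinarith
  have hlog0 : 0 ≤ Real.log (1 + T * (cm / (d * l))) := Real.log_nonneg (by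
    have : 0 ≤ T * (cm / (d * l)) := by positivity
    linarith)
  calc _ = 12 * k ^ 2 * C ^ 3 * ℓ ^ 6 * (D * W) / d ^ 2 *
        ((d * l + cm) * (d * Real.log (1 + T * (cm / (d * l))))) := by
        generalize Real.log (1 + T * (cm / (d * l))) = q
        field_simp
        ring
    _ ≤ 12 * k ^ 2 * C ^ 3 * ℓ ^ 6 * (D * W) / d ^ 2 *
        (((1 + 2 * k) * (d * ℓ)) * (d * ((4 * k + 1) * ℓ))) := by
        gcongr
    _ = _ := by
        field_simp

/-- The regret bound on the event where the self-normalised concentration bound holds. -/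
theorem regret_le {T Γ : ℕ} {S m : ℝ} {k : ℝ≥0} {τ δ Δ : ℝ} {c b : ℝ → ℝ}
    {θs a : ℕ → Vec d} {A : ℕ → Set (Vec d)} {r : ℕ → ℝ} (hd : 1 ≤ d) (hT : 2 ≤ T) (hΓ : 1 ≤ Γ)
    (hδ : 0 < δ) (hδ1 : δ ≤ 1) (hΔ : 0 < Δ) (hbd : ContDiff ℝ 2 b) (hb : IsRegularMean d S k b)
    (hm : 0 < m) (hτ : τ = d * Real.sqrt T / Real.sqrt (cMu d S b * Γ))
    (hθS : ∀ t ∈ Finset.Icc 1 T, ‖θs t‖ ≤ S) (hA : ∀ t ∈ Finset.Icc 1 T, ∀ x ∈ A t, ‖x‖ ≤ 1)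
    (hnum : numChanges T θs ≤ Γ) (hgap : HasMinGap T b θs A Δ)
    (halg : IsSWGLUCB T S m k (d * Real.log T) τ δ c b A a r)
    (hconc : ∀ t ∈ Finset.Icc 1 T, ∀ ξ : Vec d, inner ℝ (noiseVec b τ θs a r t) ξ ≤
      rho d T m k (d * Real.log T) τ δ t *
        Real.sqrt (fisherForm b τ θs a t ξ + d * Real.log T * ‖ξ‖ ^ 2)) :
    regret T b θs A a ≤ regretConst S m k * Real.log (T / δ) ^ 8 *
      (Δ⁻¹ * (Real.sqrt (cMu d S b))⁻¹ * d * Real.sqrt (Γ * T)) := by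
  have hd1 : (1 : ℝ) ≤ d := by exact_mod_cast hd
  have hT2 : (2 : ℝ) ≤ T := by exact_mod_cast hT
  have hΓ1 : (1 : ℝ) ≤ Γ := by exact_mod_cast hΓ
  have hk : (0 : ℝ) ≤ k := k.coe_nonneg
  have hl := half_le_log_of_two_le hT2
  have hTδ : (T : ℝ) ≤ T / δ := by
    rw [le_div_iff₀ hδ]
    nlinarith
  have hlℓ : Real.log T ≤ Real.log (T / δ) := Real.log_le_log (by linarith) hTδ
  have h1T : 1 ∈ Finset.Icc 1 T := Finset.mem_Icc.2 ⟨le_rfl, by omega⟩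
  have hS : 0 ≤ S := (norm_nonneg _).trans (hθS 1 h1T)
  have hc := hb.cMu_pos
  have hck := cMu_le hb hS
  have hat : ∀ t ∈ Finset.Icc 1 T, a t ∈ A t := fun t ht => (halg t ht).choose_spec.2.1
  have hlam : 0 < d * Real.log T := by positivity
  have hτ0 : 0 < τ := by rw [hτ]; positivity
  have hB := fun t (ht : t ∈ Finset.Icc 1 T) => beta_sq_le (k := k) hd hT hS hm hk hτ0.le hδ hδ1
    (Finset.mem_Icc.1 ht).2
  have hmain := regret_le_stale_add_potential hΔ hbd hb hm hlam hτ0.le (by linarith) hθS hA hgap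
    halg hconc hB
  rw [← expansionConst] at hmain
  have hC1 : 0 ≤ expansionConst S m k := by unfold expansionConst; positivity
  set C1 := expansionConst S m k with hC1def
  have hC0 := regretConst_pos hS hm hk
  set ℓ := Real.log (T / δ) with hℓ
  set l := Real.log T with hldef
  set cm := cMu d S b with hcm
  have hτ2 : cm * Γ * τ ^ 2 = d ^ 2 * T := by
    rw [hτ, div_pow, mul_pow, Real.sq_sqrt (by positivity), Real.sq_sqrt (by positivity)]
    field_simp
  -- The target rate is `Γ τ`, the order of the number of stale rounds; the previous identity shows
  -- that `d² T / (c_μ τ)` equals it as well.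
  have hW : (Real.sqrt cm)⁻¹ * d * Real.sqrt (Γ * T) = Γ * τ := by
    rw [hτ, Real.sqrt_mul (by positivity), Real.sqrt_mul (by positivity)]
    have h1 : Real.sqrt (Γ : ℝ) * Real.sqrt Γ = Γ := Real.mul_self_sqrt (by positivity)
    have h2 : 0 < Real.sqrt (Γ : ℝ) := Real.sqrt_pos.2 (by positivity)
    have h3 : 0 < Real.sqrt cm := Real.sqrt_pos.2 hc
    generalize Real.sqrt (Γ : ℝ) = g at h1 h2
    rw [← h1]
    field_simp
  rw [show Δ⁻¹ * (Real.sqrt cm)⁻¹ * d * Real.sqrt (Γ * T) = Δ⁻¹ * (Γ * τ) by rw [← hW]; ring]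
  set W := Γ * τ with hWdef
  have hW0 : 0 < W := by positivity
  set D := Δ⁻¹ with hD
  have hD0 : 0 < D := inv_pos.2 hΔ
  have hℓ8 : 1 ≤ 256 * ℓ ^ 8 := by
    have : (1 / 2 : ℝ) ^ 8 ≤ ℓ ^ 8 := pow_le_pow_left₀ (by norm_num) (by linarith) 8
    norm_num at this
    linarith
  have hreg0 : ∀ t ∈ Finset.Icc 1 T,
      0 ≤ bestMean b (θs t) (A t) - meanFn b (inner ℝ (a t) (θs t)) := fun t ht =>
    bestMean_sub_nonneg hb.lipschitz (hA t ht) (hat t ht) (hθS t ht)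
  have hreg1 : ∀ t ∈ Finset.Icc 1 T,
      bestMean b (θs t) (A t) - meanFn b (inner ℝ (a t) (θs t)) ≤ 2 * k * S := fun t ht =>
    bestMean_sub_le (hat t ht) fun x hx =>
      meanFn_sub_le hb.lipschitz (hA t ht x hx) (hA t ht _ (hat t ht)) (hθS t ht)
  by_cases hpos : ∃ t ∈ Finset.Icc 1 T,
      0 < bestMean b (θs t) (A t) - meanFn b (inner ℝ (a t) (θs t))
  swap
  · push Not at hpos
    have h1 : regret T b θs A a ≤ 0 := Finset.sum_nonpos hpos
    have h2 : 0 ≤ regretConst S m k * ℓ ^ 8 * (D * W) := by positivity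
    linarith
  -- Some positive regret forces `Δ ≤ 2 k S`, so contributions without a factor `Δ⁻¹` can be given
  -- one at the cost of a constant.
  have hDkS : 1 ≤ 2 * k * S * D := by
    obtain ⟨t, ht, h0⟩ := hpos
    have h1 : Δ ≤ 2 * k * S := (hgap t ht _ (hat t ht) (sub_pos.1 h0)).trans (hreg1 t ht)
    rwa [hD, ← div_eq_mul_inv, le_div_iff₀ hΔ, one_mul]
  have hpot0 : 0 ≤ 12 * (k : ℝ) ^ 2 * C1 ^ 3 * (1 + 2 * k) * (4 * k + 1) * ℓ ^ 8 := by positivity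
  have hstale0 : 0 ≤ 8 * (k : ℝ) ^ 2 * S ^ 2 * (1 + k) := by positivity
  have hfinal : ∀ x : ℝ, x ≤ 12 * (k : ℝ) ^ 2 * C1 ^ 3 * (1 + 2 * k) * (4 * k + 1) * ℓ ^ 8
      + 8 * k ^ 2 * S ^ 2 * (1 + k) → x * (D * W) ≤ regretConst S m k * ℓ ^ 8 * (D * W) := by
    intro x hx
    refine mul_le_mul_of_nonneg_right (hx.trans ?_) (by positivity)
    rw [regretConst, ← hC1def]
    have := mul_le_mul_of_nonneg_left hℓ8 hstale0
    nlinarith [pow_nonneg (by linarith : 0 ≤ ℓ) 8]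
  have htriv : (T : ℝ) ≤ (1 + k) * W →
      regret T b θs A a ≤ regretConst S m k * ℓ ^ 8 * (D * W) := by
    intro hTW
    have h1 : regret T b θs A a ≤ T * (2 * k * S) := by
      refine (Finset.sum_le_sum hreg1).trans (le_of_eq ?_)
      rw [Finset.sum_const, Nat.card_Icc, Nat.add_sub_cancel, nsmul_eq_mul]
    have hkS : 0 ≤ 2 * k * S := by positivity
    calc regret T b θs A a ≤ T * (2 * k * S) := h1
      _ ≤ ((1 + k) * W) * (2 * k * S) := mul_le_mul_of_nonneg_right hTW hkS
      _ ≤ ((1 + k) * W) * (2 * k * S) * (2 * k * S * D) :=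
          le_mul_of_one_le_right (by positivity) hDkS
      _ = (4 * k ^ 2 * S ^ 2 * (1 + k)) * (D * W) := by ring
      _ ≤ _ := hfinal _ (by linarith)
  -- The block argument needs `1 ≤ τ ≤ T`. Outside this range the trivial bound `2 k S T` suffices:
  -- `τ < 1` gives `T ≤ c_μ Γ τ² ≤ k W`, and `τ > T` gives `T ≤ W`.
  rcases lt_or_ge τ 1 with hτ1 | hτ1
  · refine htriv ?_
    have h1 : (T : ℝ) ≤ d ^ 2 * T := le_mul_of_one_le_left (by linarith) (one_le_pow₀ hd1)
    have h2 : cm * Γ * τ ^ 2 ≤ k * W := by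
      rw [hWdef, sq, show cm * Γ * (τ * τ) = cm * (Γ * τ * τ) by ring]
      exact mul_le_mul hck (mul_le_of_le_one_right hW0.le hτ1.le) (by positivity) hk
    linarith
  rcases lt_or_ge (T : ℝ) τ with hτT | hτT
  · refine htriv ?_
    have h1 : τ ≤ W := le_mul_of_one_le_left hτ0.le hΓ1
    linarith [mul_nonneg hk hW0.le]
  have hpot := sum_sq_matNorm_le hlam hc hτ1 hτT a
    fun s hs => hA s hs _ (hat s hs)
  have hTτ : 3 * T / τ = 3 * cm * W / d ^ 2 := by
    rw [div_eq_div_iff hτ0.ne' (by positivity), hWdef]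
    linear_combination (-3 : ℝ) * hτ2
  rw [hTτ] at hpot
  have hpotential : D * (4 * (k ^ 2 * (d * l) * (C1 * ℓ ^ 2) ^ 3) / cm) * ∑ t ∈ Finset.Icc 1 T,
      matNorm (designMatrix (d * l) cm τ a t)⁻¹ (a t) ^ 2 ≤
      12 * (k : ℝ) ^ 2 * C1 ^ 3 * (1 + 2 * k) * (4 * k + 1) * ℓ ^ 8 * (D * W) := by
    refine le_trans (mul_le_mul_of_nonneg_left hpot ?_)
      (mul_potential_le hd1 hT2 hk hc hck hC1 hlℓ hW0.le hD0.le)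
    have : 0 < l := by linarith
    positivity
  have hstale : ((staleRounds T τ θs).card : ℝ) * (2 * k * S) ≤
      8 * (k : ℝ) ^ 2 * S ^ 2 * (1 + k) * (D * W) := by
    have h1 : ((staleRounds T τ θs).card : ℝ) ≤ 2 * W := by
      refine (card_staleRounds_le T hτ0.le θs).trans ?_
      have h2 : (numChanges T θs : ℝ) ≤ Γ := by exact_mod_cast hnum
      calc _ ≤ (Γ : ℝ) * (τ + τ) := by gcongr
        _ = _ := by rw [hWdef]; ring
    have hkS : 0 ≤ 2 * k * S := by positivity
    calc _ ≤ 2 * W * (2 * k * S) := mul_le_mul_of_nonneg_right h1 hkS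
      _ ≤ 2 * W * (2 * k * S) * (2 * k * S * D) :=
          le_mul_of_one_le_right (by positivity) hDkS
      _ = 8 * k ^ 2 * S ^ 2 * 1 * (D * W) := by ring
      _ ≤ _ := by
          gcongr
          linarith
  refine le_trans ?_ (hfinal _ le_rfl)
  rw [add_mul]
  linarith

end

end GLBandit

end

theorem mainTheorem6 :
    ∃ p : ℕ, ∀ (S m : ℝ) (k : ℝ≥0), 0 < m → ∃ C : ℝ, 0 < C ∧
      ∀ (d T Γ : ℕ) (δ Δ : ℝ) (ν : Measure ℝ) (c b : ℝ → ℝ) (θs : ℕ → GLBandit.Vec d)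
        (Ω : Type*) [mΩ : MeasurableSpace Ω] (P : Measure Ω) [IsProbabilityMeasure P]
        (ℱ : Filtration ℕ mΩ) (A : ℕ → Ω → Set (GLBandit.Vec d))
        (a : ℕ → Ω → GLBandit.Vec d) (r : ℕ → Ω → ℝ),
        1 ≤ d → 2 ≤ T → 1 ≤ Γ → 0 < δ → δ ≤ 1 → 0 < Δ →
        GLBandit.IsExpFamily ν c b →
        GLBandit.IsRegularMean d S k b →
        GLBandit.IsInteraction P ℱ T S m ν c b θs A a r →
        GLBandit.numChanges T θs ≤ Γ →
        (∀ ω, GLBandit.HasMinGap T b θs (fun t => A t ω) Δ) →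
        (∀ ω, GLBandit.IsSWGLUCB T S m k
          (d * Real.log T)
          (d * Real.sqrt T / Real.sqrt (GLBandit.cMu d S b * Γ))
          δ c b (fun t => A t ω) (fun t => a t ω) (fun t => r t ω)) →
        P {ω | C * Real.log (T / δ) ^ p *
            (Δ⁻¹ * (Real.sqrt (GLBandit.cMu d S b))⁻¹ * d * Real.sqrt (Γ * T))
              < GLBandit.regret T b θs (fun t => A t ω) (fun t => a t ω)}
          ≤ ENNReal.ofReal δ := by
  -- The constant must be positive for every real `S`, before any interaction shows `S ≥ 0`; hence
  -- `|S|`.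
  refine ⟨8, fun S m k hm => ⟨GLBandit.regretConst |S| m k,
    GLBandit.regretConst_pos (abs_nonneg S) hm k.coe_nonneg, ?_⟩⟩
  intro d T Γ δ Δ ν c b θs Ω mΩ P hP ℱ A a r hd hT hΓ hδ hδ1 hΔ hf hb hI hnum hgap halg
  have hT2 : (2 : ℝ) ≤ T := by exact_mod_cast hT
  have hd1 : (1 : ℝ) ≤ d := by exact_mod_cast hd
  have hlam : 0 < d * Real.log T := by
    have := GLBandit.half_le_log_of_two_le hT2
    positivity
  have hS : 0 ≤ S :=
    (norm_nonneg _).trans (hI.norm_param_le 1 (Finset.mem_Icc.2 ⟨le_rfl, by omega⟩))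
  have hconc := hI.measure_exists_rho_lt_le hf hb hd hm hlam
    (by positivity : 0 ≤ d * Real.sqrt T / Real.sqrt (GLBandit.cMu d S b * Γ)) hδ (by omega)
  refine (measure_mono fun ω hω hgood => ?_).trans hconc
  rw [abs_of_nonneg hS] at hω
  exact (GLBandit.regret_le hd hT hΓ hδ hδ1 hΔ hf.contDiff_b hb hm rfl hI.norm_param_le
    (fun t ht => hI.norm_action_le t ht ω) hnum (hgap ω) (halg ω) hgood).not_gt hω
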